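/- Let $L>0$ and $\mathcal D=(0,L)\times(0,1)$ with coordinates $(x,z)$. Let $\mathbb L$ be the Leray projection, i.e. the orthogonal projection of $L^2(\mathcal D)^2$ onto the fields $(u,w)$ with $\operatorname{div}(u,w)=0$ in $\mathcal D$ and zero normal component on $\partial\mathcal D$. Let $H_1$ be the set of $\psi=(u,w,\theta)\in H^2(\mathcal D)^3$ with $\operatorname{div}(u,w)=0$, $u=\partial_x w=\partial_x\theta=0$ at $x=0,L$, and $w=\theta=\partial_z u=0$ at $z=0,1$. For $\mathrm{Ra}>0$ and $\psi\in H_1$ put $$A\psi=(-\mathbb L\Delta(u,w),\,-\Delta\theta),\qquad P_{\mathrm{Ra}}\psi=(\sqrt{\mathrm{Ra}}\,\mathbb L(0,\theta),\,\sqrt{\mathrm{Ra}}\,w),\qquad L_{\mathrm{Ra}}=-A+P_{\mathrm{Ra}},$$ and $\|\psi\|_\nu=\sqrt{\langle A\psi,\psi\rangle}$, where $\langle\cdot,\cdot\rangle$ and $\|\cdot\|$ are the inner product and norm of $L^2(\mathcal D)^3$. For integers $j,k\ge1$ let $\alpha_j=j\pi/L$, $\gamma_{jk}=\sqrt{\alpha_j^2+k^2\pi^2}$,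 and $\mathrm{Ra}_c=\min_{j,k\ge1}\gamma_{jk}^6/\alpha_j^2$. Assume that $L$ is not in the exceptional set of those $L>0$ for which $j_1=\lfloor L/\sqrt2\rfloor\ge1$ and $j_2=\lceil L/\sqrt2\rceil$ are distinct and $(1+j_1^2/L^2)^3/j_1^2=(1+j_2^2/L^2)^3/j_2^2$; the minimum is then attained at exactly one index, denoted $(j_c,1)$. The eigenmodes of $L_{\mathrm{Ra}}$ are, for $j,k\ge1$, $e_{0k}=\sqrt{2/L}\,(0,0,\sin k\pi z)$ and $$e_{jk}^\pm=N_{jk}^\pm\Bigl(-k\pi\sin(\alpha_jx)\cos(k\pi z),\ \alpha_j\cos(\alpha_jx)\sin(k\pi z),\ \tfrac{\sqrt{\mathrm{Ra}}\,\alpha_j}{\gamma_{jk}^2+\beta_{jk}^\pm}\cos(\alpha_jx)\sin(k\pi z)\Bigr),\qquad \beta_{jk}^\pm=-\gamma_{jk}^2\pm\sqrt{\mathrm{Ra}\,\alpha_j^2/\gamma_{jk}^2},$$ with normalization constants $$N_{jk}^\pm=\left(\frac{4(\gamma_{jk}^2+\beta_{jk}^\pm)^2}{L\bigl(\gamma_{jk}^2(\gamma_{jk}^2+\beta_{jk}^\pm)^2+\mathrm{Ra}\,\alpha_j^2\bigr)}\right)^{1/2}.$$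 Let the stable subspace $H_{\mathfrak s}=H_{\mathfrak s}(\mathrm{Ra})$ be the closed linear span in $L^2(\mathcal D)^3$ of all these modes except $e^+_{j_c1}$. Then there exist $\eta\in(0,1)$, $\delta>0$ and $\mathrm{Ra}^*>\mathrm{Ra}_c$ such that for all $\mathrm{Ra}\in[\mathrm{Ra}_c,\mathrm{Ra}^*]$ and all $\psi\in H_1\cap H_{\mathfrak s}$, $$\langle -\eta A\psi+P_{\mathrm{Ra}}\psi,\psi\rangle\le-\delta\|\psi\|^2\qquad\text{and}\qquad \langle -\eta A\psi+P_{\mathrm{Ra}}\psi,A\psi\rangle\le-\delta\|\psi\|_\nu^2 .$$ -/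

import Mathlib

open MeasureTheory
open scoped ContDiff

noncomputable section

namespace RBC

/-- The rectangle `(0, L) × (0, 1)`, with coordinates `(x, z)`. -/
def domain (L : ℝ) : Set (ℝ × ℝ) := Set.Ioo 0 L ×ˢ Set.Ioo 0 1

/-- The real Hilbert space `L²` of the rectangle. -/
abbrev L2 (L : ℝ) : Type := Lp ℝ 2 (volume.restrict (domain L))

/-- `(L²)²`, the space of square integrable velocity fields `(u, w)`, with its Hilbert norm. -/
abbrev Velocity (L : ℝ) : Type := PiLp 2 (fun _ : Fin 2 => L2 L)

/-- `(L²)³`, the space of square integrable states `ψ = (u, w, θ)`, with its Hilbert norm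
`‖ψ‖² = |u|² + |w|² + |θ|²`. -/
abbrev State (L : ℝ) : Type := PiLp 2 (fun _ : Fin 3 => L2 L)

theorem memLp_of_continuous (L : ℝ) {f : ℝ × ℝ → ℝ} (hf : Continuous f) :
    MemLp f 2 (volume.restrict (domain L)) := by
  have hK : IsCompact (Set.Icc (0 : ℝ) L ×ˢ Set.Icc (0 : ℝ) 1) := isCompact_Icc.prod isCompact_Icc
  have hsub : domain L ⊆ Set.Icc (0 : ℝ) L ×ˢ Set.Icc (0 : ℝ) 1 :=
    Set.prod_mono Set.Ioo_subset_Icc_self Set.Ioo_subset_Icc_self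
  obtain ⟨C, hC⟩ := hK.exists_bound_of_continuousOn hf.continuousOn
  have hm : MeasurableSet (domain L) := measurableSet_Ioo.prod measurableSet_Ioo
  have : IsFiniteMeasure (volume.restrict (domain L)) :=
    ⟨by
      rw [Measure.restrict_apply_univ]
      exact (measure_mono hsub).trans_lt hK.measure_lt_top⟩
  refine MemLp.of_bound hf.aestronglyMeasurable C ?_
  filter_upwards [ae_restrict_mem hm] with p hp
  exact hC p (hsub hp)

/-- The class in `L²` of the rectangle of a continuous function on the plane. -/
def ofCont (L : ℝ) (f : C(ℝ × ℝ, ℝ)) : L2 L := (memLp_of_continuous L f.continuous).toLp f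

/-! ### Weak derivatives, Sobolev spaces, boundary values -/

/-- `g` is the weak derivative of `f` on the open rectangle in the direction `v`:
`∫ f ∂ᵥφ = - ∫ g φ` for all test functions `φ` in `C_c^∞` of the rectangle. -/
def IsWeakDeriv (L : ℝ) (v : ℝ × ℝ) (f g : L2 L) : Prop :=
  ∀ φ : ℝ × ℝ → ℝ, ContDiff ℝ ∞ φ → HasCompactSupport φ → tsupport φ ⊆ domain L →
    ∫ p in domain L, f p * fderiv ℝ φ p v = - ∫ p in domain L, g p * φ p

open Classical in
/-- The weak derivative of `f` in the direction `v` (it is unique if it exists; the value is `0`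
if there is none in `L²`). -/
def weakDeriv (L : ℝ) (v : ℝ × ℝ) (f : L2 L) : L2 L :=
  if h : ∃ g, IsWeakDeriv L v f g then h.choose else 0

/-- `∂f/∂x`. -/
abbrev dx (L : ℝ) (f : L2 L) : L2 L := weakDeriv L (1, 0) f

/-- `∂f/∂z`. -/
abbrev dz (L : ℝ) (f : L2 L) : L2 L := weakDeriv L (0, 1) f

/-- `f ∈ H¹`. -/
def MemH1 (L : ℝ) (f : L2 L) : Prop :=
  (∃ g, IsWeakDeriv L (1, 0) f g) ∧ (∃ g, IsWeakDeriv L (0, 1) f g)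

/-- `f ∈ H²`. -/
def MemH2 (L : ℝ) (f : L2 L) : Prop :=
  MemH1 L f ∧ MemH1 L (dx L f) ∧ MemH1 L (dz L f)

/-- The Laplacian of `f ∈ H²`. -/
def lap (L : ℝ) (f : L2 L) : L2 L := dx L (dx L f) + dz L (dz L f)

/-- `f = 0` at `x = 0` and at `x = L`, for `f ∈ H¹`, in the sense of traces. By Green's formula
`∫ (f ∂ₓφ + ∂ₓf φ) = ∫₀¹ (f φ)(L, z) dz - ∫₀¹ (f φ)(0, z) dz` for every `φ` that is smooth up to the
boundary (no condition on the support of `φ`), so the traces vanish if and only if the left-hand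
side does for all these `φ`. -/
def ZeroAtLateral (L : ℝ) (f : L2 L) : Prop :=
  ∀ φ : ℝ × ℝ → ℝ, ContDiff ℝ ∞ φ →
    ∫ p in domain L, f p * fderiv ℝ φ p (1, 0) = - ∫ p in domain L, dx L f p * φ p

/-- `f = 0` at `z = 0` and at `z = 1`, for `f ∈ H¹`, in the sense of traces (as for the lateral
boundary). -/
def ZeroAtTopBottom (L : ℝ) (f : L2 L) : Prop :=
  ∀ φ : ℝ × ℝ → ℝ, ContDiff ℝ ∞ φ →
    ∫ p in domain L, f p * fderiv ℝ φ p (0, 1) = - ∫ p in domain L, dz L f p * φ p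

/-! ### Function spaces and operators of the Rayleigh–Bénard problem -/

theorem integrable_mul_of_continuous (L : ℝ) (f : L2 L) {g : ℝ × ℝ → ℝ} (hg : Continuous g) :
    Integrable (fun p => f p * g p) (volume.restrict (domain L)) :=
  (Lp.memLp f).integrable_mul (memLp_of_continuous L hg)

theorem continuous_fderiv_apply_of_smooth {φ : ℝ × ℝ → ℝ} (hφ : ContDiff ℝ ∞ φ) (v : ℝ × ℝ) :
    Continuous fun p => fderiv ℝ φ p v :=
  (hφ.continuous_fderiv (by simp)).clm_apply continuous_const

/-- The solenoidal fields: those `(u, w) ∈ (L²)²` with `div (u, w) = 0` in the rectangle and zero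
normal component on its boundary. In the usual weak sense the two conditions together say that
`∫ (u, w) · ∇φ = 0` for every `φ` that is smooth up to the boundary. -/
def solenoidal (L : ℝ) : Submodule ℝ (Velocity L) where
  carrier := {v | ∀ φ : ℝ × ℝ → ℝ, ContDiff ℝ ∞ φ →
    (∫ p in domain L, v 0 p * fderiv ℝ φ p (1, 0)) +
      (∫ p in domain L, v 1 p * fderiv ℝ φ p (0, 1)) = 0}
  zero_mem' := by
    intro φ _
    have h : ∀ e : ℝ × ℝ, ∫ p in domain L, (0 : L2 L) p * fderiv ℝ φ p e = 0 := by
      intro e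
      refine integral_eq_zero_of_ae ?_
      filter_upwards [Lp.coeFn_zero ℝ 2 (volume.restrict (domain L))] with p hp
      rw [hp]
      simp
    simp only [PiLp.zero_apply]
    rw [h, h, add_zero]
  add_mem' := by
    intro a b ha hb φ hφ
    have h : ∀ (f g : L2 L) (e : ℝ × ℝ), ∫ p in domain L, (f + g : L2 L) p * fderiv ℝ φ p e =
        (∫ p in domain L, f p * fderiv ℝ φ p e) + ∫ p in domain L, g p * fderiv ℝ φ p e := by
      intro f g e
      have hc := continuous_fderiv_apply_of_smooth hφ e
      rw [← integral_add (integrable_mul_of_continuous L f hc)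
        (integrable_mul_of_continuous L g hc)]
      refine integral_congr_ae ?_
      filter_upwards [Lp.coeFn_add f g] with p hp
      rw [hp, Pi.add_apply, add_mul]
    have h1 := ha φ hφ
    have h2 := hb φ hφ
    simp only [PiLp.add_apply, h]
    linarith
  smul_mem' := by
    intro c a ha φ hφ
    have h : ∀ (f : L2 L) (e : ℝ × ℝ), ∫ p in domain L, (c • f : L2 L) p * fderiv ℝ φ p e =
        c * ∫ p in domain L, f p * fderiv ℝ φ p e := by
      intro f e
      rw [← integral_const_mul]
      refine integral_congr_ae ?_
      filter_upwards [Lp.coeFn_smul c f] with p hp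
      rw [hp, Pi.smul_apply, smul_eq_mul, mul_assoc]
    have h1 := ha φ hφ
    simp only [PiLp.smul_apply, h]
    rw [← mul_add, h1, mul_zero]

theorem isClosed_solenoidal (L : ℝ) : IsClosed (solenoidal L : Set (Velocity L)) := by
  have key : ∀ {g : ℝ × ℝ → ℝ}, Continuous g → ∀ i : Fin 2,
      Continuous fun v : Velocity L => ∫ p in domain L, v i p * g p := by
    intro g hg i
    have h : (fun v : Velocity L => ∫ p in domain L, v i p * g p) =
        fun v : Velocity L => inner ℝ (ofCont L ⟨g, hg⟩) (v i) := by
      funext v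
      rw [L2.inner_def]
      refine integral_congr_ae ?_
      filter_upwards [(memLp_of_continuous L hg).coeFn_toLp] with p hp
      have hp' : (ofCont L ⟨g, hg⟩ : L2 L) p = g p := hp
      simp [hp']
    rw [h]
    exact continuous_const.inner (PiLp.continuous_apply 2 _ i)
  have h : (solenoidal L : Set (Velocity L)) = ⋂ φ : ℝ × ℝ → ℝ, ⋂ _ : ContDiff ℝ ∞ φ,
      {v : Velocity L | (∫ p in domain L, v 0 p * fderiv ℝ φ p (1, 0)) +
        (∫ p in domain L, v 1 p * fderiv ℝ φ p (0, 1)) = 0} := by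
    ext v
    simp only [Set.mem_iInter]
    rfl
  rw [h]
  refine isClosed_iInter fun φ => isClosed_iInter fun hφ => ?_
  exact isClosed_eq ((key (continuous_fderiv_apply_of_smooth hφ _) 0).add
    (key (continuous_fderiv_apply_of_smooth hφ _) 1)) continuous_const

instance (L : ℝ) : CompleteSpace (solenoidal L) := (isClosed_solenoidal L).completeSpace_coe

/-- The Leray projection: the orthogonal projection of `(L²)²` onto the solenoidal fields. -/
def leray (L : ℝ) : Velocity L →L[ℝ] Velocity L := (solenoidal L).starProjection

/-- The domain of the linear operators: the states `(u, w, θ)` in `(H²)³` with `div (u, w) = 0`,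
`u = ∂w/∂x = ∂θ/∂x = 0` at `x = 0, L` and `w = θ = ∂u/∂z = 0` at `z = 0, 1`. -/
structure MemDomain (L : ℝ) (ψ : State L) : Prop where
  memH2 : ∀ i, MemH2 L (ψ i)
  div_eq_zero : dx L (ψ 0) + dz L (ψ 1) = 0
  u_lateral : ZeroAtLateral L (ψ 0)
  dx_w_lateral : ZeroAtLateral L (dx L (ψ 1))
  dx_θ_lateral : ZeroAtLateral L (dx L (ψ 2))
  w_topBottom : ZeroAtTopBottom L (ψ 1)
  θ_topBottom : ZeroAtTopBottom L (ψ 2)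
  dz_u_topBottom : ZeroAtTopBottom L (dz L (ψ 0))

/-- `A (u, w, θ) = (-𝕃 Δ(u, w), -Δθ)`, for states in the domain. -/
def opA (L : ℝ) (ψ : State L) : State L :=
  let v : Velocity L := leray L (WithLp.toLp 2 ![lap L (ψ 0), lap L (ψ 1)])
  WithLp.toLp 2 ![-v 0, -v 1, -lap L (ψ 2)]

/-- `P_Ra (u, w, θ) = (√Ra 𝕃(0, θ), √Ra w)`. -/
def opP (L Ra : ℝ) (ψ : State L) : State L :=
  let v : Velocity L := leray L (WithLp.toLp 2 ![0, ψ 2])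
  WithLp.toLp 2 ![√Ra • v 0, √Ra • v 1, √Ra • ψ 1]

/-- The norm `‖ψ‖_ν = √⟨Aψ, ψ⟩`, for states in the domain of `A`. -/
def nuNorm (L : ℝ) (ψ : State L) : ℝ := √(inner ℝ (opA L ψ) ψ)

/-! ### The critical Rayleigh number -/

/-- `α_j = jπ/L`. -/
def wavenum (L : ℝ) (j : ℕ) : ℝ := j * Real.pi / L

/-- `γ_jk = √(α_j² + k²π²)`. -/
def gam (L : ℝ) (j k : ℕ) : ℝ := √(wavenum L j ^ 2 + (k : ℝ) ^ 2 * Real.pi ^ 2)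

/-- `γ_jk⁶ / α_j²`, the Rayleigh number at which the mode of wave vector `(j, k)` is marginal. -/
def marginalRa (L : ℝ) (j k : ℕ) : ℝ := gam L j k ^ 6 / wavenum L j ^ 2

/-- The critical Rayleigh number, the minimum of `γ_jk⁶ / α_j²` over the integers `j, k ≥ 1`. -/
def Rac (L : ℝ) : ℝ := sInf {r | ∃ j k : ℕ, 1 ≤ j ∧ 1 ≤ k ∧ r = marginalRa L j k}

/-- The exceptional set of the lengths `L` for which the minimum that defines the critical Rayleigh
number is attained at two wave vectors. If `⌊L/√2⌋ = 0` then there is only the wave vector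
`(1, 1)`, and `L` is not exceptional. -/
def exceptionalSet : Set ℝ :=
  {L | 0 < L ∧ 1 ≤ ⌊L / √2⌋₊ ∧ ⌊L / √2⌋₊ ≠ ⌈L / √2⌉₊ ∧
    (1 + (⌊L / √2⌋₊ : ℝ) ^ 2 / L ^ 2) ^ 3 / (⌊L / √2⌋₊ : ℝ) ^ 2 =
      (1 + (⌈L / √2⌉₊ : ℝ) ^ 2 / L ^ 2) ^ 3 / (⌈L / √2⌉₊ : ℝ) ^ 2}

/-! ### The eigenmodes of `-A + P_Ra` and the stable subspace -/

/-- The eigenvalue `β_jk^±(Ra) = -γ_jk² ± √(Ra α_j² / γ_jk²)`; the sign is `s = 1` or `s = -1`. -/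
def eigenvalue (L Ra s : ℝ) (j k : ℕ) : ℝ :=
  -gam L j k ^ 2 + s * √(Ra * wavenum L j ^ 2 / gam L j k ^ 2)

/-- The normalization constant `N_jk^±`. -/
def normalization (L Ra s : ℝ) (j k : ℕ) : ℝ :=
  √(4 * (gam L j k ^ 2 + eigenvalue L Ra s j k) ^ 2 /
    (L * (gam L j k ^ 2 * (gam L j k ^ 2 + eigenvalue L Ra s j k) ^ 2 + Ra * wavenum L j ^ 2)))

/-- The eigenmodes of group one, `e_0k = √(2/L) (0, 0, sin(kπz))`, for `k ≥ 1`. -/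
def mode0 (L : ℝ) (k : ℕ) : State L :=
  WithLp.toLp 2 ![0, 0, ofCont L ⟨fun p => √(2 / L) * Real.sin (k * Real.pi * p.2), by fun_prop⟩]

/-- The eigenmodes of group two, for `j, k ≥ 1` and the sign `s = 1` or `s = -1`,
`e_jk^± = (a sin(α_j x) cos(kπz), b cos(α_j x) sin(kπz), c cos(α_j x) sin(kπz))` with
`a = -kπ N_jk^±`, `b = α_j N_jk^±` and `c = √Ra α_j / (γ_jk² + β_jk^±) N_jk^±`. -/
def mode (L Ra s : ℝ) (j k : ℕ) : State L :=
  WithLp.toLp 2 ![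
    ofCont L ⟨fun p => -(k * Real.pi * normalization L Ra s j k) *
      (Real.sin (wavenum L j * p.1) * Real.cos (k * Real.pi * p.2)), by fun_prop⟩,
    ofCont L ⟨fun p => wavenum L j * normalization L Ra s j k *
      (Real.cos (wavenum L j * p.1) * Real.sin (k * Real.pi * p.2)), by fun_prop⟩,
    ofCont L ⟨fun p => √Ra * wavenum L j / (gam L j k ^ 2 + eigenvalue L Ra s j k) *
      normalization L Ra s j k *
      (Real.cos (wavenum L j * p.1) * Real.sin (k * Real.pi * p.2)), by fun_prop⟩]

/-- The stable modes: all eigenmodes of `-A + P_Ra` except the critical one `e_{jc 1}^+`. -/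
def stableModes (L Ra : ℝ) (jc : ℕ) : Set (State L) :=
  {ψ | ∃ k : ℕ, 1 ≤ k ∧ ψ = mode0 L k} ∪
  {ψ | ∃ j k : ℕ, 1 ≤ j ∧ 1 ≤ k ∧ ψ = mode L Ra (-1) j k} ∪
  {ψ | ∃ j k : ℕ, 1 ≤ j ∧ 1 ≤ k ∧ (j, k) ≠ (jc, 1) ∧ ψ = mode L Ra 1 j k}

/-- The stable subspace, the closed linear span of the stable modes. -/
def stableSubspace (L Ra : ℝ) (jc : ℕ) : Submodule ℝ (State L) :=
  (Submodule.span ℝ (stableModes L Ra jc)).topologicalClosure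

end RBC

end

/-! Everything is diagonal in the eigenmodes. They form an orthonormal family
(`orthonormal_modeFamily`), and `P_Ra` maps the mode of wave vector `(j, k)` and sign `±` to `±√Ra
α/γ` times itself and annihilates `e_0k` (`opP_modeFamily`). Integration by parts, with the boundary
conditions of the domain, gives `⟨Aψ, e⟩ = γ² ⟨ψ, e⟩` for every mode `e` (`inner_opA_modeFamily`).
Expanding `ψ` in the stable modes reduces both estimates to the scalar inequality `-η γ² + p ≤ -δ`,
where `p` is the eigenvalue of `P_Ra` (`Orthonormal.energy_estimates`).

For a `+` mode, `p = γ² √(Ra / R)` with `R = γ⁶/α²` its marginal Rayleigh number. Off the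
exceptional set the minimum `Ra_c` of `R` has a single minimizer, and `R` tends to infinity with
`(j, k)`, so `R ≥ ρ > Ra_c` for all other wave vectors (`exists_gap`). With `Ra* ∈ (Ra_c, ρ)` and
`√(Ra*/ρ) < η < 1`, the bound `γ ≥ π` gives `δ = π² (η - √(Ra*/ρ))` (`rate_bound`). -/

/-! ### Expansions and energy estimates in an orthonormal system -/

theorem Orthonormal.hasSum_inner_smul {ι H : Type*} [NormedAddCommGroup H]
    [InnerProductSpace ℝ H] [CompleteSpace H] {e : ι → H} (he : Orthonormal ℝ e) {ψ : H}
    (hψ : ψ ∈ (Submodule.span ℝ (Set.range e)).topologicalClosure) :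
    HasSum (fun i => inner ℝ (e i) ψ • e i) ψ := by
  set K := (Submodule.span ℝ (Set.range e)).topologicalClosure with hK
  have hmem : ∀ i, e i ∈ K := fun i =>
    Submodule.le_topologicalClosure _ (Submodule.subset_span ⟨i, rfl⟩)
  have : CompleteSpace K := (Submodule.isClosed_topologicalClosure _).completeSpace_coe
  have he' : Orthonormal ℝ (fun i => (⟨e i, hmem i⟩ : K)) := by
    classical
    rw [orthonormal_iff_ite] at he ⊢
    exact he
  -- Completeness inside `K`: a vector of `K` orthogonal to the family is orthogonal to the closed
  -- span, which is `K`, hence to itself.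
  have hbot : (Submodule.span ℝ (Set.range fun i => (⟨e i, hmem i⟩ : K)))ᗮ = ⊥ := by
    rw [Submodule.eq_bot_iff]
    rintro ⟨x, hx⟩ hx'
    have h1 : x ∈ (Submodule.span ℝ (Set.range e))ᗮ := by
      rw [Submodule.mem_orthogonal]
      intro y hy
      induction hy using Submodule.span_induction with
      | mem y hy =>
        obtain ⟨i, rfl⟩ := hy
        exact (Submodule.mem_orthogonal _ _).1 hx' ⟨e i, hmem i⟩ (Submodule.subset_span ⟨i, rfl⟩)
      | zero => simp
      | add a b _ _ ha hb => rw [inner_add_left, ha, hb, add_zero]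
      | smul c a _ ha => rw [inner_smul_left, ha, mul_zero]
    rw [← Submodule.orthogonal_closure] at h1
    have h2 : inner ℝ x x = 0 := (Submodule.mem_orthogonal _ _).1 h1 x hx
    ext
    simpa using h2
  have hs := (HilbertBasis.mkOfOrthogonalEqBot he' hbot).hasSum_repr ⟨ψ, hψ⟩
  have hs' := K.subtypeL.hasSum hs
  simpa [HilbertBasis.repr_apply_apply] using hs'

/-- Energy estimates for a perturbation `B` (a map with an adjoint) of an operator which, like `B`,
is diagonal in an orthonormal system; `φ` plays the role of the value of the operator at `ψ`. -/
theorem Orthonormal.energy_estimates {ι H : Type*} [NormedAddCommGroup H]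
    [InnerProductSpace ℝ H] [CompleteSpace H] {e : ι → H} (he : Orthonormal ℝ e) {ψ φ : H}
    (hψ : ψ ∈ (Submodule.span ℝ (Set.range e)).topologicalClosure) {B : H → H}
    (hB : ∀ y, ∃ y', ∀ x, inner ℝ (B x) y = inner ℝ x y') {p g : ι → ℝ} (hBe : ∀ i, B (e i) = p i • e i)
    (hφ : ∀ i, inner ℝ φ (e i) = g i * inner ℝ ψ (e i)) (hg : ∀ i, 0 ≤ g i) {η δ : ℝ}
    (hη : 0 ≤ η) (hle : ∀ i, -η * g i + p i ≤ -δ) :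
    0 ≤ inner ℝ φ ψ ∧ inner ℝ (-(η • φ) + B ψ) ψ ≤ -δ * ‖ψ‖ ^ 2 ∧
      inner ℝ (-(η • φ) + B ψ) φ ≤ -δ * inner ℝ φ ψ := by
  have hs := he.hasSum_inner_smul hψ
  set a : ι → ℝ := fun i => inner ℝ (e i) ψ with ha
  have key : ∀ y : H, HasSum (fun i => a i * inner ℝ y (e i)) (inner ℝ y ψ) := by
    intro y
    have := (innerSL ℝ y).hasSum hs
    simpa [inner_smul_right] using this
  have hφψ : HasSum (fun i => g i * a i ^ 2) (inner ℝ φ ψ) := by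
    convert key φ using 2 with i
    rw [hφ, real_inner_comm]
    ring
  have hψψ : HasSum (fun i => a i ^ 2) (‖ψ‖ ^ 2) := by
    convert key ψ using 2 with i
    · rw [real_inner_comm]
      ring
    · rw [real_inner_self_eq_norm_sq]
  -- No continuity of `B` is needed: the adjoint moves `B` onto `y`, `ψ` is expanded, and `B` is
  -- moved back onto each `e i`.
  have hBy : ∀ y, HasSum (fun i => p i * a i * inner ℝ y (e i)) (inner ℝ (B ψ) y) := by
    intro y
    obtain ⟨y', hy'⟩ := hB y
    rw [hy', real_inner_comm]
    convert key y' using 2 with i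
    rw [real_inner_comm (e i) y', ← hy', hBe, inner_smul_left, real_inner_comm (e i) y]
    simp only [conj_trivial]
    ring
  have hBψ : HasSum (fun i => p i * a i ^ 2) (inner ℝ (B ψ) ψ) := by
    convert hBy ψ using 2 with i
    rw [real_inner_comm]
    ring
  have hBφ : HasSum (fun i => p i * g i * a i ^ 2) (inner ℝ (B ψ) φ) := by
    convert hBy φ using 2 with i
    rw [hφ, real_inner_comm]
    ring
  -- `φ` need not lie in the closed span of the system, so only Bessel's inequality is available for
  -- `‖φ‖²`. It suffices, since `‖φ‖²` enters with the factor `-η ≤ 0`.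
  have hbessel : Summable fun i => (g i * a i) ^ 2 := by
    convert he.inner_products_summable (x := φ) using 2 with i
    rw [real_inner_comm, hφ, real_inner_comm, Real.norm_eq_abs, sq_abs]
  have hbessel' : ∑' i, (g i * a i) ^ 2 ≤ ‖φ‖ ^ 2 := by
    convert he.tsum_inner_products_le (x := φ) using 3 with i
    rw [real_inner_comm, hφ, real_inner_comm, Real.norm_eq_abs, sq_abs]
  refine ⟨hφψ.nonneg fun i => by have := hg i; positivity, ?_, ?_⟩
  · rw [inner_add_left, inner_neg_left, inner_smul_left]
    refine hasSum_le (fun i => ?_) ((hφψ.mul_left η).neg.add hBψ) (hψψ.mul_left (-δ))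
    have := mul_le_mul_of_nonneg_right (hle i) (sq_nonneg (a i))
    linarith
  · rw [inner_add_left, inner_neg_left, inner_smul_left, real_inner_self_eq_norm_sq]
    have h1 := hasSum_le (fun i => ?_) ((hbessel.hasSum.mul_left η).neg.add hBφ)
      (hφψ.mul_left (-δ))
    · have := mul_le_mul_of_nonneg_left hbessel' hη
      simp only [conj_trivial]
      linarith
    · have := mul_le_mul_of_nonneg_right (hle i) (mul_nonneg (hg i) (sq_nonneg (a i)))
      linarith

namespace RBC

/-! ### The critical Rayleigh number and the gap above it -/

theorem gam_sq (L : ℝ) (j k : ℕ) :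
    gam L j k ^ 2 = wavenum L j ^ 2 + (k : ℝ) ^ 2 * Real.pi ^ 2 :=
  Real.sq_sqrt (by positivity)

theorem marginalRa_eq (L : ℝ) (j k : ℕ) :
    marginalRa L j k = (wavenum L j ^ 2 + (k : ℝ) ^ 2 * Real.pi ^ 2) ^ 3 / wavenum L j ^ 2 := by
  rw [marginalRa, ← gam_sq, ← pow_mul]

theorem wavenum_pos {L : ℝ} (hL : 0 < L) {j : ℕ} (hj : 1 ≤ j) : 0 < wavenum L j := by
  have : (0 : ℝ) < j := by exact_mod_cast hj
  unfold wavenum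
  positivity

theorem Rac_le (L : ℝ) {j k : ℕ} (hj : 1 ≤ j) (hk : 1 ≤ k) : Rac L ≤ marginalRa L j k := by
  refine csInf_le ⟨0, ?_⟩ ⟨j, k, hj, hk, rfl⟩
  rintro _ ⟨j, k, -, -, rfl⟩
  rw [marginalRa_eq]
  positivity

theorem marginalRa_one_eq {L : ℝ} (hL : 0 < L) {j : ℕ} (hj : 1 ≤ j) :
    marginalRa L j 1 = Real.pi ^ 4 * L ^ 2 * ((1 + (j : ℝ) ^ 2 / L ^ 2) ^ 3 / (j : ℝ) ^ 2) := by
  have : (0 : ℝ) < j := by exact_mod_cast hj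
  rw [marginalRa_eq, wavenum]
  field_simp
  ring

theorem marginalRa_one_lt {L : ℝ} (hL : 0 < L) {j k : ℕ} (hj : 1 ≤ j) (hk : 1 < k) :
    marginalRa L j 1 < marginalRa L j k := by
  have hw := wavenum_pos hL hj
  have hk' : (1 : ℝ) < k := by exact_mod_cast hk
  rw [marginalRa_eq, marginalRa_eq]
  have : ((1 : ℕ) : ℝ) ^ 2 < (k : ℝ) ^ 2 := by
    rw [Nat.cast_one]
    nlinarith
  gcongr

/-- The function `j ↦ (1 + j²/L²)³ / j²` takes equal minimal values at two consecutive integers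
only. -/
theorem mem_exceptionalSet {L : ℝ} (hL : 0 < L) {j j' : ℕ} (hj : 1 ≤ j) (hjj : j < j')
    (h : marginalRa L j 1 = Rac L) (h' : marginalRa L j' 1 = Rac L) : L ∈ exceptionalSet := by
  have hpos : ∀ {i : ℕ}, 1 ≤ i → (0 : ℝ) < i := fun hi => by exact_mod_cast hi
  have hval : ∀ {i : ℕ}, 1 ≤ i → marginalRa L i 1 =
      Real.pi ^ 4 * ((1 + (i : ℝ) ^ 2 / L ^ 2) ^ 3 / ((i : ℝ) ^ 2 / L ^ 2)) := by
    intro i hi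
    have := hpos hi
    rw [marginalRa_one_eq hL hi]
    field_simp
  have hpi : 0 < Real.pi ^ 4 := by positivity
  have hj' : 1 ≤ j' := hj.trans hjj.le
  obtain ⟨t, ht⟩ : ∃ t, t = (j : ℝ) ^ 2 / L ^ 2 := ⟨_, rfl⟩
  obtain ⟨t', ht'⟩ : ∃ t, t = (j' : ℝ) ^ 2 / L ^ 2 := ⟨_, rfl⟩
  have h0 : 0 < t := by have := hpos hj; rw [ht]; positivity
  have hmono : ∀ {a b : ℕ}, a < b → (a : ℝ) ^ 2 / L ^ 2 < (b : ℝ) ^ 2 / L ^ 2 := by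
    intro a b hab
    have : (a : ℝ) < b := by exact_mod_cast hab
    gcongr
  have htt : t < t' := by rw [ht, ht']; exact hmono hjj
  have heq : (1 + t) ^ 3 / t = (1 + t') ^ 3 / t' := by
    have := h.trans h'.symm
    rw [hval hj, hval hj', ← ht, ← ht'] at this
    exact mul_left_cancel₀ hpi.ne' this
  -- After cross-multiplication the difference of the two values factors as `(t' - t) (t t' (3 + t +
  -- t') - 1)`, up to sign.
  have hprod : t * t' * (3 + t + t') = 1 := by
    rw [div_eq_div_iff h0.ne' (h0.trans htt).ne'] at heq
    have : (t' - t) * (t * t' * (3 + t + t') - 1) = 0 := by linarith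
    rcases mul_eq_zero.1 this with h | h <;> linarith
  -- At an intermediate point `s` one has `t s (3 + t + s) < 1`, so by the same factorization the
  -- value there is below the value at `t`, against minimality.
  have hsucc : j' = j + 1 := by
    by_contra hne
    have hlt : j + 1 < j' := by omega
    obtain ⟨s, hs⟩ : ∃ t, t = ((j + 1 : ℕ) : ℝ) ^ 2 / L ^ 2 := ⟨_, rfl⟩
    have hts : t < s := by rw [ht, hs]; exact hmono (Nat.lt_succ_self j)
    have hst : s < t' := by rw [hs, ht']; exact hmono hlt
    have hmin := h.trans_le (Rac_le L (show 1 ≤ j + 1 by omega) le_rfl)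
    rw [hval hj, hval (show 1 ≤ j + 1 by omega), ← ht, ← hs] at hmin
    have hmin' := le_of_mul_le_mul_left hmin hpi
    rw [div_le_div_iff₀ h0 (h0.trans hts)] at hmin'
    have h1 : t * s * (3 + t + s) < t * t' * (3 + t + t') := by
      have := h0.trans hts
      gcongr
    have : 0 < (s - t) * (1 - t * s * (3 + t + s)) :=
      mul_pos (by linarith) (by linarith)
    linarith
  -- For `t = t' = 1/2` the product `t t' (3 + t + t')` equals `1`, so the two points lie on
  -- opposite sides of `1/2`, the minimizer of `(1 + t)³ / t`. In terms of `j` this threshold is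
  -- `L/√2`.
  have ht1 : t < 1 / 2 := by
    by_contra hc
    push Not at hc
    have h1 : 1 / 2 * (1 / 2) < t * t' := mul_lt_mul' hc (by linarith) (by norm_num) h0
    nlinarith
  have ht2 : 1 / 2 < t' := by
    by_contra hc
    push Not at hc
    have h1 : t * t' < 1 / 2 * (1 / 2) := mul_lt_mul ht1 hc (h0.trans htt) (by norm_num)
    nlinarith
  have hs2 : (0 : ℝ) < √2 := by positivity
  have hlow : (j : ℝ) < L / √2 := by
    refine lt_of_pow_lt_pow_left₀ 2 (by positivity) ?_
    rw [div_pow, Real.sq_sqrt (by norm_num)]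
    rw [ht, div_lt_iff₀ (by positivity)] at ht1
    linarith
  have hupp : L / √2 < (j : ℝ) + 1 := by
    refine lt_of_pow_lt_pow_left₀ 2 (by positivity) ?_
    rw [div_pow, Real.sq_sqrt (by norm_num)]
    rw [ht', hsucc, lt_div_iff₀ (by positivity)] at ht2
    push_cast at ht2
    linarith
  have hfl : ⌊L / √2⌋₊ = j := (Nat.floor_eq_iff (by positivity)).2 ⟨hlow.le, hupp⟩
  have hce : ⌈L / √2⌉₊ = j + 1 := by
    rw [Nat.ceil_eq_iff (by omega)]
    push_cast
    exact ⟨by simpa using hlow, hupp.le⟩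
  refine ⟨hL, by omega, by omega, ?_⟩
  rw [hfl, hce, ← hsucc]
  have := h.trans h'.symm
  rw [marginalRa_one_eq hL hj, marginalRa_one_eq hL hj'] at this
  exact mul_left_cancel₀ (by positivity) this

/-- For `k > 1` the marginal number exceeds the one with `k = 1`; for `k = 1` a second minimizer
would make `L` exceptional. -/
theorem Rac_lt_marginalRa {L : ℝ} (hL : 0 < L) (hLS : L ∉ exceptionalSet) {jc : ℕ} (hjc : 1 ≤ jc)
    (hcrit : marginalRa L jc 1 = Rac L) {j k : ℕ} (hj : 1 ≤ j) (hk : 1 ≤ k)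
    (hne : (j, k) ≠ (jc, 1)) : Rac L < marginalRa L j k := by
  rcases hk.lt_or_eq with hk | rfl
  · exact (Rac_le L hj le_rfl).trans_lt (marginalRa_one_lt hL hj hk)
  · refine (Rac_le L hj le_rfl).lt_of_ne fun h => hLS ?_
    rcases lt_trichotomy j jc with hlt | rfl | hlt
    · exact mem_exceptionalSet hL hj hlt h.symm hcrit
    · exact absurd rfl hne
    · exact mem_exceptionalSet hL hjc hlt hcrit h.symm

/-- Crude growth, enough to leave finitely many competitors for the minimum: `γ⁶/α² ≥ γ²` because
`γ⁴ ≥ α²`, and `γ²` dominates both `j/L²` and `k`. -/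
theorem marginalRa_ge {L : ℝ} (hL : 0 < L) {j k : ℕ} (hj : 1 ≤ j) (hk : 1 ≤ k) :
    (j : ℝ) / L ^ 2 ≤ marginalRa L j k ∧ (k : ℝ) ≤ marginalRa L j k := by
  have hw := wavenum_pos hL hj
  have hj' : (1 : ℝ) ≤ j := by exact_mod_cast hj
  have hk' : (1 : ℝ) ≤ k := by exact_mod_cast hk
  have hpi : 1 ≤ Real.pi ^ 2 := by nlinarith [Real.pi_gt_three]
  have hkk : (k : ℝ) ≤ (k : ℝ) ^ 2 * Real.pi ^ 2 := by
    have : (k : ℝ) * 1 ≤ (k : ℝ) ^ 2 * Real.pi ^ 2 := by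
      gcongr
      nlinarith
    linarith
  have hjj : (j : ℝ) / L ^ 2 ≤ wavenum L j ^ 2 := by
    rw [wavenum, div_pow]
    gcongr
    have : (j : ℝ) * 1 ≤ (j : ℝ) ^ 2 * Real.pi ^ 2 := by
      gcongr
      nlinarith
    linarith
  have hb : wavenum L j ^ 2 + (k : ℝ) ^ 2 * Real.pi ^ 2 ≤ marginalRa L j k := by
    rw [marginalRa_eq, le_div_iff₀ (by positivity)]
    have aux : ∀ w q : ℝ, 0 < w → 1 ≤ q → (w + q) * w ≤ (w + q) ^ 3 := by
      intro w q hw0 hq1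
      have h1 : w ≤ (w + q) ^ 2 := by nlinarith
      calc (w + q) * w ≤ (w + q) * (w + q) ^ 2 := by gcongr
        _ = (w + q) ^ 3 := by ring
    exact aux _ _ (by positivity) (by linarith)
  have : 0 ≤ wavenum L j ^ 2 := by positivity
  have : 0 ≤ (k : ℝ) ^ 2 * Real.pi ^ 2 := by positivity
  constructor <;> linarith

theorem exists_gap {L : ℝ} (hL : 0 < L) (hLS : L ∉ exceptionalSet) {jc : ℕ} (hjc : 1 ≤ jc)
    (hcrit : marginalRa L jc 1 = Rac L) : ∃ ρ > Rac L, ∀ j k : ℕ, 1 ≤ j → 1 ≤ k →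
      (j, k) ≠ (jc, 1) → ρ ≤ marginalRa L j k := by
  classical
  -- Once `j ≥ M` or `k ≥ M`, the marginal number is at least `Rac L + 1`; the remaining wave
  -- vectors form a finite set with a positive gap.
  obtain ⟨M, hM⟩ := exists_nat_gt (max (Rac L + 1) ((Rac L + 1) * L ^ 2))
  have hM1 := (le_max_left _ _).trans_lt hM
  have hM2 := (le_max_right _ _).trans_lt hM
  set S := (Finset.range M ×ˢ Finset.range M).filter
    fun q : ℕ × ℕ => 1 ≤ q.1 ∧ 1 ≤ q.2 ∧ q ≠ (jc, 1) with hS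
  have hlt : ∀ q ∈ S, Rac L < marginalRa L q.1 q.2 := by
    rintro ⟨j, k⟩ hq
    simp only [hS, Finset.mem_filter] at hq
    exact Rac_lt_marginalRa hL hLS hjc hcrit hq.2.1 hq.2.2.1 hq.2.2.2
  obtain ⟨ρ, hρ, hρS⟩ : ∃ ρ > Rac L, ∀ q ∈ S, ρ ≤ marginalRa L q.1 q.2 := by
    rcases S.eq_empty_or_nonempty with he | hne
    · exact ⟨Rac L + 1, by linarith, by simp [he]⟩
    · obtain ⟨q, hq, hmin⟩ := S.exists_min_image (fun q => marginalRa L q.1 q.2) hne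
      exact ⟨_, hlt q hq, hmin⟩
  refine ⟨min ρ (Rac L + 1), lt_min hρ (by linarith), fun j k hj hk hne => ?_⟩
  by_cases hmem : (j, k) ∈ S
  · have h1 : ρ ≤ marginalRa L j k := hρS (j, k) hmem
    exact (min_le_left _ _).trans h1
  · refine (min_le_right _ _).trans ?_
    obtain ⟨h1, h2⟩ := marginalRa_ge hL hj hk
    have : M ≤ j ∨ M ≤ k := by
      by_contra hc
      push Not at hc
      exact hmem (by simp [hS, hc.1, hc.2, hj, hk, hne])
    rcases this with h | h
    · have h' : (M : ℝ) ≤ j := by exact_mod_cast h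
      refine le_trans ?_ h1
      rw [le_div_iff₀ (by positivity)]
      linarith
    · have h' : (M : ℝ) ≤ k := by exact_mod_cast h
      linarith

/-! ### Cutoffs, and weak derivatives tested up to the boundary -/

theorem measurableSet_domain (L : ℝ) : MeasurableSet (domain L) :=
  measurableSet_Ioo.prod measurableSet_Ioo

/-- A smooth cutoff of the interval `(0, a)`, equal to `1` at distance at least `2 / n` from the
end points. -/
noncomputable def cutoff (a : ℝ) (n : ℕ) (x : ℝ) : ℝ :=
  Real.smoothTransition (n * x - 1) * Real.smoothTransition (n * (a - x) - 1)

theorem contDiff_cutoff (a : ℝ) (n : ℕ) : ContDiff ℝ ∞ (cutoff a n) := by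
  have h : ContDiff ℝ ∞ Real.smoothTransition := Real.smoothTransition.contDiff
  unfold cutoff
  exact (h.comp (by fun_prop)).mul (h.comp (by fun_prop))

theorem cutoff_nonneg (a : ℝ) (n : ℕ) (x : ℝ) : 0 ≤ cutoff a n x :=
  mul_nonneg (Real.smoothTransition.nonneg _) (Real.smoothTransition.nonneg _)

theorem cutoff_le_one (a : ℝ) (n : ℕ) (x : ℝ) : cutoff a n x ≤ 1 :=
  mul_le_one₀ (Real.smoothTransition.le_one _) (Real.smoothTransition.nonneg _)
    (Real.smoothTransition.le_one _)

theorem one_le_mul_of_cutoff_ne_zero {a : ℝ} {n : ℕ} {x : ℝ} (h : cutoff a n x ≠ 0) :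
    1 ≤ n * x ∧ 1 ≤ n * (a - x) := by
  by_contra hc
  rw [not_and_or, not_le, not_le] at hc
  refine h ?_
  rcases hc with hc | hc
  · rw [cutoff, Real.smoothTransition.zero_of_nonpos (by linarith), zero_mul]
  · rw [cutoff, Real.smoothTransition.zero_of_nonpos (x := n * (a - x) - 1) (by linarith), mul_zero]

theorem eventually_cutoff_eq_one {a x : ℝ} (hx : x ∈ Set.Ioo 0 a) :
    ∀ᶠ n : ℕ in Filter.atTop, ∀ᶠ y in nhds x, cutoff a n y = 1 := by
  have h1 : Filter.Tendsto (fun n : ℕ => (n : ℝ) * (x / 2)) Filter.atTop Filter.atTop :=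
    tendsto_natCast_atTop_atTop.atTop_mul_const (by linarith [hx.1])
  have h2 : Filter.Tendsto (fun n : ℕ => (n : ℝ) * ((a - x) / 2)) Filter.atTop Filter.atTop :=
    tendsto_natCast_atTop_atTop.atTop_mul_const (by linarith [hx.2])
  filter_upwards [h1.eventually_ge_atTop 2, h2.eventually_ge_atTop 2] with n hn1 hn2
  filter_upwards [Ioo_mem_nhds (show x / 2 < x by linarith [hx.1])
    (show x < x + (a - x) / 2 by linarith [hx.2])] with y hy
  have hy1 : (n : ℝ) * (x / 2) ≤ n * y := by gcongr; exact hy.1.le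
  have hy2 : (n : ℝ) * ((a - x) / 2) ≤ n * (a - y) := by gcongr; linarith [hy.2]
  rw [cutoff, Real.smoothTransition.one_of_one_le (by linarith),
    Real.smoothTransition.one_of_one_le (by linarith), one_mul]

/-- The product is bounded on `[0, 2]` by compactness and vanishes beyond, where the transition is
constant. Applied with `y = n x`, it bounds `x` times the derivative of the rescaled transition
uniformly in `n`. -/
theorem exists_mul_deriv_smoothTransition_le :
    ∃ M, ∀ y, 0 ≤ y → y * |deriv Real.smoothTransition (y - 1)| ≤ M := by
  have h : ContDiff ℝ 1 Real.smoothTransition := Real.smoothTransition.contDiff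
  have hc : Continuous (deriv Real.smoothTransition) := h.continuous_deriv le_rfl
  have hc' : Continuous fun y => y * |deriv Real.smoothTransition (y - 1)| := by fun_prop
  obtain ⟨M, hM⟩ := (isCompact_Icc (a := (0 : ℝ)) (b := 2)).exists_bound_of_continuousOn
    hc'.continuousOn
  have hM0 : 0 ≤ M := (norm_nonneg _).trans (hM 0 (by simp))
  refine ⟨M, fun y hy => ?_⟩
  by_cases hy2 : y ≤ 2
  · exact (le_abs_self _).trans (hM y ⟨hy, hy2⟩)
  · have : Real.smoothTransition =ᶠ[nhds (y - 1)] fun _ => 1 := by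
      filter_upwards [Ioi_mem_nhds (show 1 < y - 1 by linarith)] with z hz
      exact Real.smoothTransition.one_of_one_le (le_of_lt hz)
    rw [this.deriv_eq]
    simpa using hM0

/-- The derivative of the cutoff is of the order of the inverse distance to the end points,
uniformly in `n`; a factor `c` that is at most a multiple of this distance compensates it. -/
theorem exists_mul_deriv_cutoff_le : ∃ M, ∀ (a : ℝ) (n : ℕ), ∀ x ∈ Set.Ioo 0 a, ∀ c C : ℝ,
    |c| ≤ C * x → |c| ≤ C * (a - x) → |c * deriv (cutoff a n) x| ≤ C * M := by
  obtain ⟨M, hM⟩ := exists_mul_deriv_smoothTransition_le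
  refine ⟨M + M, fun a n x hx c C h1 h2 => ?_⟩
  have hd : Differentiable ℝ Real.smoothTransition :=
    (Real.smoothTransition.contDiff (n := 1)).differentiable (by simp)
  have hx0 := hx.1
  have hx1 : 0 < a - x := sub_pos.2 hx.2
  have hC : 0 ≤ C := by
    by_contra hc
    push Not at hc
    nlinarith [abs_nonneg c]
  have hder : HasDerivAt (cutoff a n)
      (deriv Real.smoothTransition (n * x - 1) * n * Real.smoothTransition (n * (a - x) - 1) +
        Real.smoothTransition (n * x - 1) *
          (deriv Real.smoothTransition (n * (a - x) - 1) * (-n))) x := by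
    have e1 : HasDerivAt (fun x : ℝ => n * x - 1) (n : ℝ) x := by
      simpa using ((hasDerivAt_id x).const_mul (n : ℝ)).sub_const 1
    have e2 : HasDerivAt (fun x : ℝ => n * (a - x) - 1) (-n : ℝ) x := by
      simpa using (((hasDerivAt_id x).const_sub a).const_mul (n : ℝ)).sub_const 1
    exact ((hd _).hasDerivAt.comp x e1).mul ((hd _).hasDerivAt.comp x e2)
  rw [hder.deriv]
  have hn : (0 : ℝ) ≤ n := n.cast_nonneg
  have m1 := hM (n * x) (by positivity)
  have m2 := hM (n * (a - x)) (by positivity)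
  set d1 := deriv Real.smoothTransition (n * x - 1)
  set d2 := deriv Real.smoothTransition (n * (a - x) - 1)
  set s1 := Real.smoothTransition (n * x - 1) with hs1
  set s2 := Real.smoothTransition (n * (a - x) - 1) with hs2
  have a1 : |s1| ≤ 1 := by
    rw [hs1, abs_of_nonneg (Real.smoothTransition.nonneg _)]
    exact Real.smoothTransition.le_one _
  have a2 : |s2| ≤ 1 := by
    rw [hs2, abs_of_nonneg (Real.smoothTransition.nonneg _)]
    exact Real.smoothTransition.le_one _
  calc |c * (d1 * n * s2 + s1 * (d2 * -n))|
      = |c * d1 * n * s2 + -(c * d2 * n * s1)| := by congr 1; ring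
    _ ≤ |c * d1 * n * s2| + |-(c * d2 * n * s1)| := abs_add_le _ _
    _ = |c| * |d1| * n * |s2| + |c| * |d2| * n * |s1| := by
        rw [abs_neg]; simp only [abs_mul, Nat.abs_cast]
    _ ≤ (C * x) * |d1| * n * 1 + (C * (a - x)) * |d2| * n * 1 := by gcongr
    _ = C * (n * x * |d1|) + C * (n * (a - x) * |d2|) := by ring
    _ ≤ C * M + C * M := by gcongr
    _ = C * (M + M) := by ring

/-- The product cutoff of the rectangle. -/
noncomputable def boxCutoff (L : ℝ) (n : ℕ) (p : ℝ × ℝ) : ℝ := cutoff L n p.1 * cutoff 1 n p.2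

theorem contDiff_boxCutoff (L : ℝ) (n : ℕ) : ContDiff ℝ ∞ (boxCutoff L n) :=
  ((contDiff_cutoff L n).comp contDiff_fst).mul ((contDiff_cutoff 1 n).comp contDiff_snd)

theorem boxCutoff_nonneg (L : ℝ) (n : ℕ) (p : ℝ × ℝ) : 0 ≤ boxCutoff L n p :=
  mul_nonneg (cutoff_nonneg _ _ _) (cutoff_nonneg _ _ _)

theorem boxCutoff_le_one (L : ℝ) (n : ℕ) (p : ℝ × ℝ) : boxCutoff L n p ≤ 1 :=
  mul_le_one₀ (cutoff_le_one _ _ _) (cutoff_nonneg _ _ _) (cutoff_le_one _ _ _)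

theorem eventually_boxCutoff_eq_one {L : ℝ} {p : ℝ × ℝ} (hp : p ∈ domain L) :
    ∀ᶠ n : ℕ in Filter.atTop, boxCutoff L n =ᶠ[nhds p] fun _ => 1 := by
  filter_upwards [eventually_cutoff_eq_one hp.1, eventually_cutoff_eq_one hp.2] with n h1 h2
  filter_upwards [continuousAt_fst.eventually h1, continuousAt_snd.eventually h2] with q hq1 hq2
  rw [boxCutoff, hq1, hq2, one_mul]

theorem hasCompactSupport_boxCutoff (L : ℝ) (n : ℕ) :
    HasCompactSupport (boxCutoff L n) ∧ tsupport (boxCutoff L n) ⊆ domain L := by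
  set K : Set (ℝ × ℝ) :=
    {p | (1 ≤ n * p.1 ∧ 1 ≤ n * (L - p.1)) ∧ (1 ≤ n * p.2 ∧ 1 ≤ n * (1 - p.2))} with hK
  have hKc : IsClosed K := by
    have : K = ({p : ℝ × ℝ | 1 ≤ n * p.1} ∩ {p | 1 ≤ n * (L - p.1)}) ∩
        ({p | 1 ≤ n * p.2} ∩ {p | 1 ≤ n * (1 - p.2)}) := rfl
    rw [this]
    refine IsClosed.inter (IsClosed.inter ?_ ?_) (IsClosed.inter ?_ ?_) <;>
      exact isClosed_le (by fun_prop) (by fun_prop)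
  have hsub : tsupport (boxCutoff L n) ⊆ K := by
    refine closure_minimal (fun p hp => ?_) hKc
    have hp' : cutoff L n p.1 * cutoff 1 n p.2 ≠ 0 := hp
    exact ⟨one_le_mul_of_cutoff_ne_zero (left_ne_zero_of_mul hp'),
      one_le_mul_of_cutoff_ne_zero (right_ne_zero_of_mul hp')⟩
  have hpos : ∀ y : ℝ, 1 ≤ n * y → 0 < y := by
    intro y hy
    by_contra hc
    push Not at hc
    have := mul_nonpos_of_nonneg_of_nonpos (n.cast_nonneg (α := ℝ)) hc
    linarith
  have hKd : K ⊆ domain L := fun p hp =>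
    ⟨⟨hpos _ hp.1.1, by linarith [hpos _ hp.1.2]⟩, ⟨hpos _ hp.2.1, by linarith [hpos _ hp.2.2]⟩⟩
  refine ⟨?_, hsub.trans hKd⟩
  refine ((isCompact_Icc (a := (0 : ℝ)) (b := L)).prod
    (isCompact_Icc (a := (0 : ℝ)) (b := 1))).of_isClosed_subset (isClosed_tsupport _) ?_
  exact (hsub.trans hKd).trans (Set.prod_mono Set.Ioo_subset_Icc_self Set.Ioo_subset_Icc_self)

/-- Weak derivatives may be tested with smooth functions that are not compactly supported, provided
the derivatives of the cutoff stay under control. -/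
theorem IsWeakDeriv.integral_eq_of_bound {L : ℝ} {v : ℝ × ℝ} {f g : L2 L}
    (h : IsWeakDeriv L v f g) {φ : ℝ × ℝ → ℝ} (hφ : ContDiff ℝ ∞ φ) {C : ℝ}
    (hC : ∀ n, ∀ p ∈ domain L, |φ p * fderiv ℝ (boxCutoff L n) p v| ≤ C) :
    ∫ p in domain L, f p * fderiv ℝ φ p v = - ∫ p in domain L, g p * φ p := by
  have hmeas := ae_restrict_mem (μ := volume) (measurableSet_domain L)
  have hcd := contDiff_boxCutoff L
  have hdφ : Continuous fun p => fderiv ℝ φ p v := continuous_fderiv_apply_of_smooth hφ v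
  have hdc : ∀ n, Continuous fun p => fderiv ℝ (boxCutoff L n) p v := fun n =>
    continuous_fderiv_apply_of_smooth (hcd n) v
  have hprod : ∀ n p, fderiv ℝ (fun p => φ p * boxCutoff L n p) p v =
      φ p * fderiv ℝ (boxCutoff L n) p v + boxCutoff L n p * fderiv ℝ φ p v := by
    intro n p
    rw [fderiv_fun_mul (hφ.differentiable (by simp) p) ((hcd n).differentiable (by simp) p)]
    simp
  have hn : ∀ n, ∫ p in domain L, f p * (φ p * fderiv ℝ (boxCutoff L n) p v +
      boxCutoff L n p * fderiv ℝ φ p v) = - ∫ p in domain L, g p * (φ p * boxCutoff L n p) := by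
    intro n
    obtain ⟨hc1, hc2⟩ := hasCompactSupport_boxCutoff L n
    rw [← h (fun p => φ p * boxCutoff L n p) (hφ.mul (hcd n)) (hc1.mul_left)
      ((tsupport_mul_subset_right).trans hc2)]
    simp only [hprod]
  have hff : Integrable (fun p => f p) (volume.restrict (domain L)) := by
    simpa using integrable_mul_of_continuous L f (continuous_const (y := (1 : ℝ)))
  -- Near each point of the open rectangle the cutoff is eventually constant, so the term with its
  -- derivative tends to `0` pointwise; `hC` supplies the domination.
  have lim1 : Filter.Tendsto (fun n => ∫ p in domain L, f p *
      (φ p * fderiv ℝ (boxCutoff L n) p v + boxCutoff L n p * fderiv ℝ φ p v)) Filter.atTop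
      (nhds (∫ p in domain L, f p * fderiv ℝ φ p v)) := by
    refine tendsto_integral_of_dominated_convergence
      (fun p => |f p| * C + |f p * fderiv ℝ φ p v|) (fun n => ?_) ?_ (fun n => ?_) ?_
    · exact (Lp.aestronglyMeasurable f).mul
        (((hφ.continuous.mul (hdc n)).add ((hcd n).continuous.mul hdφ)).aestronglyMeasurable)
    · exact (hff.abs.mul_const C).add (integrable_mul_of_continuous L f hdφ).abs
    · filter_upwards [hmeas] with p hp
      rw [mul_add, Real.norm_eq_abs]
      refine (abs_add_le _ _).trans (add_le_add ?_ ?_)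
      · rw [abs_mul]
        exact mul_le_mul_of_nonneg_left (hC n p hp) (abs_nonneg _)
      · rw [mul_left_comm, abs_mul, abs_of_nonneg (boxCutoff_nonneg L n p)]
        exact mul_le_of_le_one_left (abs_nonneg _) (boxCutoff_le_one L n p)
    · filter_upwards [hmeas] with p hp
      refine tendsto_const_nhds.congr' ?_
      filter_upwards [eventually_boxCutoff_eq_one hp] with n hn
      rw [hn.fderiv_eq, hn.eq_of_nhds]
      simp
  have lim2 : Filter.Tendsto (fun n => - ∫ p in domain L, g p * (φ p * boxCutoff L n p))
      Filter.atTop (nhds (- ∫ p in domain L, g p * φ p)) := by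
    refine (tendsto_integral_of_dominated_convergence
      (fun p => |g p * φ p|) (fun n => ?_) ?_ (fun n => ?_) ?_).neg
    · exact (Lp.aestronglyMeasurable g).mul
        ((hφ.continuous.mul (hcd n).continuous).aestronglyMeasurable)
    · exact (integrable_mul_of_continuous L g hφ.continuous).abs
    · filter_upwards [hmeas] with p hp
      rw [← mul_assoc, Real.norm_eq_abs, abs_mul, abs_of_nonneg (boxCutoff_nonneg L n p)]
      exact mul_le_of_le_one_right (abs_nonneg _) (boxCutoff_le_one L n p)
    · filter_upwards [hmeas] with p hp
      refine tendsto_const_nhds.congr' ?_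
      filter_upwards [eventually_boxCutoff_eq_one hp] with n hn
      rw [hn.eq_of_nhds, mul_one]
  simp only [hn] at lim1
  exact tendsto_nhds_unique lim1 lim2

theorem fderiv_boxCutoff (L : ℝ) (n : ℕ) (p : ℝ × ℝ) :
    fderiv ℝ (boxCutoff L n) p (1, 0) = deriv (cutoff L n) p.1 * cutoff 1 n p.2 ∧
      fderiv ℝ (boxCutoff L n) p (0, 1) = cutoff L n p.1 * deriv (cutoff 1 n) p.2 := by
  have hd : ∀ a, Differentiable ℝ (cutoff a n) := fun a =>
    (contDiff_cutoff a n).differentiable (by simp)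
  have h := ((hd L p.1).hasDerivAt.hasFDerivAt.comp p hasFDerivAt_fst).mul
    ((hd 1 p.2).hasDerivAt.hasFDerivAt.comp p hasFDerivAt_snd)
  have h' : HasFDerivAt (boxCutoff L n) _ p := h
  rw [h'.fderiv]
  constructor <;> simp [mul_comm]

/-- A test function vanishing linearly at `x = 0, L` needs no boundary condition on `f`. Nothing is
required at `z = 0, 1`, since the derivative in `x` does not fall on the cutoff in `z`. -/
theorem IsWeakDeriv.integral_eq_of_lateral {L : ℝ} {f g : L2 L}
    (h : IsWeakDeriv L (1, 0) f g) {φ : ℝ × ℝ → ℝ} (hφ : ContDiff ℝ ∞ φ) {C : ℝ}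
    (h1 : ∀ p ∈ domain L, |φ p| ≤ C * p.1) (h2 : ∀ p ∈ domain L, |φ p| ≤ C * (L - p.1)) :
    ∫ p in domain L, f p * fderiv ℝ φ p (1, 0) = - ∫ p in domain L, g p * φ p := by
  obtain ⟨M, hM⟩ := exists_mul_deriv_cutoff_le
  refine h.integral_eq_of_bound hφ (C := C * M) fun n p hp => ?_
  rw [(fderiv_boxCutoff L n p).1, ← mul_assoc, abs_mul, abs_of_nonneg (cutoff_nonneg _ _ _)]
  exact (mul_le_of_le_one_right (abs_nonneg _) (cutoff_le_one _ _ _)).trans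
    (hM L n p.1 hp.1 _ C (h1 p hp) (h2 p hp))

theorem IsWeakDeriv.integral_eq_of_topBottom {L : ℝ} {f g : L2 L}
    (h : IsWeakDeriv L (0, 1) f g) {φ : ℝ × ℝ → ℝ} (hφ : ContDiff ℝ ∞ φ) {C : ℝ}
    (h1 : ∀ p ∈ domain L, |φ p| ≤ C * p.2) (h2 : ∀ p ∈ domain L, |φ p| ≤ C * (1 - p.2)) :
    ∫ p in domain L, f p * fderiv ℝ φ p (0, 1) = - ∫ p in domain L, g p * φ p := by
  obtain ⟨M, hM⟩ := exists_mul_deriv_cutoff_le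
  refine h.integral_eq_of_bound hφ (C := C * M) fun n p hp => ?_
  rw [(fderiv_boxCutoff L n p).2, mul_left_comm, abs_mul, abs_of_nonneg (cutoff_nonneg _ _ _)]
  exact (mul_le_of_le_one_left (abs_nonneg _) (cutoff_le_one _ _ _)).trans
    (hM 1 n p.2 hp.2 _ C (h1 p hp) (h2 p hp))

theorem isWeakDeriv_weakDeriv {L : ℝ} {v : ℝ × ℝ} {f : L2 L} (h : ∃ g, IsWeakDeriv L v f g) :
    IsWeakDeriv L v f (weakDeriv L v f) := by
  rw [weakDeriv, dif_pos h]
  exact h.choose_spec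

/-! ### Pairings with continuous functions -/

theorem integral_ofCont_mul (L : ℝ) (f : C(ℝ × ℝ, ℝ)) (g : ℝ × ℝ → ℝ) :
    ∫ p in domain L, ofCont L f p * g p = ∫ p in domain L, f p * g p := by
  refine integral_congr_ae ?_
  filter_upwards [(memLp_of_continuous L f.continuous).coeFn_toLp] with p hp
  have hp' : (ofCont L f : L2 L) p = f p := hp
  rw [hp']

theorem inner_ofCont (L : ℝ) (f : L2 L) (g : C(ℝ × ℝ, ℝ)) :
    inner ℝ f (ofCont L g) = ∫ p in domain L, f p * g p := by
  rw [real_inner_comm, L2.inner_def, ← integral_congr_ae]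
  filter_upwards [(memLp_of_continuous L g.continuous).coeFn_toLp] with p hp
  have hp' : (ofCont L g : L2 L) p = g p := hp
  simp [hp']

theorem ofCont_const_mul (L r : ℝ) (f g : C(ℝ × ℝ, ℝ)) (h : ∀ p, f p = r * g p) :
    ofCont L f = r • ofCont L g := by
  have : (f : ℝ × ℝ → ℝ) = r • (g : ℝ × ℝ → ℝ) := by
    funext p
    simp [h]
  unfold ofCont
  rw [← MemLp.toLp_const_smul]
  exact MemLp.toLp_congr _ _ (by rw [this])

/-! ### Products of trigonometric functions on the rectangle -/

theorem fderiv_separated {F G F' G' : ℝ → ℝ} (hF : ∀ x, HasDerivAt F (F' x) x)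
    (hG : ∀ x, HasDerivAt G (G' x) x) (a b : ℝ) (p : ℝ × ℝ) :
    fderiv ℝ (fun p : ℝ × ℝ => F (a * p.1) * G (b * p.2)) p (1, 0) =
        a * (F' (a * p.1) * G (b * p.2)) ∧
      fderiv ℝ (fun p : ℝ × ℝ => F (a * p.1) * G (b * p.2)) p (0, 1) =
        b * (F (a * p.1) * G' (b * p.2)) := by
  have e : ∀ c x : ℝ, HasDerivAt (fun x : ℝ => c * x) c x := fun c x => by
    simpa using (hasDerivAt_id x).const_mul c
  have h1 := ((hF (a * p.1)).comp p.1 (e a p.1)).hasFDerivAt.comp p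
    (hasFDerivAt_fst (𝕜 := ℝ) (E := ℝ) (F := ℝ))
  have h2 := ((hG (b * p.2)).comp p.2 (e b p.2)).hasFDerivAt.comp p
    (hasFDerivAt_snd (𝕜 := ℝ) (E := ℝ) (F := ℝ))
  have h : HasFDerivAt (fun p : ℝ × ℝ => F (a * p.1) * G (b * p.2)) _ p := h1.mul h2
  rw [h.fderiv]
  constructor <;> simp <;> ring

theorem hasDerivAt_cos (x : ℝ) : HasDerivAt Real.cos ((fun y => -Real.sin y) x) x :=
  Real.hasDerivAt_cos x

theorem wavenum_mul {L : ℝ} (hL : 0 < L) (j : ℕ) : wavenum L j * L = j * Real.pi := by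
  unfold wavenum
  field_simp

theorem wavenum_nonneg {L : ℝ} (hL : 0 < L) (j : ℕ) : 0 ≤ wavenum L j := by
  unfold wavenum
  positivity

/-- The second bound is the first one after the reflection `x ↦ T - x`, which preserves `|sin (a
x)|` because `a T` is a multiple of `π`. -/
theorem abs_sin_mul_le {a T : ℝ} (ha : 0 ≤ a) {m : ℕ} (hm : a * T = m * Real.pi) {x : ℝ}
    (hx : x ∈ Set.Ioo 0 T) : |Real.sin (a * x)| ≤ a * x ∧ |Real.sin (a * x)| ≤ a * (T - x) := by
  have hx0 := hx.1
  have hx1 : 0 < T - x := sub_pos.2 hx.2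
  constructor
  · refine Real.abs_sin_le_abs.trans_eq (abs_of_nonneg (by positivity))
  · have : |Real.sin (a * x)| = |Real.sin (a * (T - x))| := by
      rw [mul_sub, hm, Real.sin_sub, Real.sin_nat_mul_pi, Real.cos_nat_mul_pi, zero_mul, zero_sub,
        abs_neg, abs_mul, abs_pow, abs_neg, abs_one, one_pow, one_mul]
    rw [this]
    exact Real.abs_sin_le_abs.trans_eq (abs_of_nonneg (by positivity))

theorem lateral_bounds {L : ℝ} (hL : 0 < L) (j : ℕ) {G : ℝ → ℝ} (hG : ∀ x, |G x| ≤ 1)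
    {p : ℝ × ℝ} (hp : p ∈ domain L) :
    |Real.sin (wavenum L j * p.1) * G p.2| ≤ wavenum L j * p.1 ∧
      |Real.sin (wavenum L j * p.1) * G p.2| ≤ wavenum L j * (L - p.1) := by
  obtain ⟨h1, h2⟩ := abs_sin_mul_le (wavenum_nonneg hL j) (wavenum_mul hL j) hp.1
  have : |Real.sin (wavenum L j * p.1) * G p.2| ≤ |Real.sin (wavenum L j * p.1)| := by
    rw [abs_mul]
    exact mul_le_of_le_one_right (abs_nonneg _) (hG _)
  exact ⟨this.trans h1, this.trans h2⟩

theorem topBottom_bounds {L : ℝ} (k : ℕ) {F : ℝ → ℝ} (hF : ∀ x, |F x| ≤ 1)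
    {p : ℝ × ℝ} (hp : p ∈ domain L) :
    |F p.1 * Real.sin (k * Real.pi * p.2)| ≤ k * Real.pi * p.2 ∧
      |F p.1 * Real.sin (k * Real.pi * p.2)| ≤ k * Real.pi * (1 - p.2) := by
  obtain ⟨h1, h2⟩ := abs_sin_mul_le (a := k * Real.pi) (by positivity) (mul_one _) hp.2
  have : |F p.1 * Real.sin (k * Real.pi * p.2)| ≤ |Real.sin (k * Real.pi * p.2)| := by
    rw [abs_mul]
    exact mul_le_of_le_one_left (abs_nonneg _) (hF _)
  exact ⟨this.trans h1, this.trans h2⟩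

/-- The profile `sin(α_j x) cos(kπz)` of the horizontal velocity. -/
noncomputable def sinCos (L : ℝ) (j k : ℕ) : C(ℝ × ℝ, ℝ) :=
  ⟨fun p => Real.sin (wavenum L j * p.1) * Real.cos (k * Real.pi * p.2), by fun_prop⟩

/-- The profile `cos(α_j x) sin(kπz)` of the vertical velocity and of the temperature. -/
noncomputable def cosSin (L : ℝ) (j k : ℕ) : C(ℝ × ℝ, ℝ) :=
  ⟨fun p => Real.cos (wavenum L j * p.1) * Real.sin (k * Real.pi * p.2), by fun_prop⟩

/-! ### The Laplacian tested against the trigonometric profiles -/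

theorem integral_mul_const_mul {L : ℝ} (f : L2 L) (r : ℝ) (g : ℝ × ℝ → ℝ) :
    ∫ p in domain L, f p * (r * g p) = r * ∫ p in domain L, f p * g p := by
  rw [← integral_const_mul]
  congr 1
  funext p
  ring

theorem integral_lap_mul {L : ℝ} (f : L2 L) {g : ℝ × ℝ → ℝ} (hg : Continuous g) :
    ∫ p in domain L, lap L f p * g p = (∫ p in domain L, dx L (dx L f) p * g p) +
      ∫ p in domain L, dz L (dz L f) p * g p := by
  rw [← integral_add (integrable_mul_of_continuous L _ hg) (integrable_mul_of_continuous L _ hg)]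
  refine integral_congr_ae ?_
  filter_upwards [Lp.coeFn_add (dx L (dx L f)) (dz L (dz L f))] with p hp
  rw [lap, hp, Pi.add_apply, add_mul]

/-- Two integrations by parts in each direction. Each boundary term vanishes: where the test
function is a sine in the direction of differentiation (`a1`, `b2`) by itself, and where it is a
cosine (`a2`, `b1`) by the boundary condition on `f` or `dz L f`. -/
theorem inner_lap_sinCos {L : ℝ} (hL : 0 < L) {f : L2 L} (hf : MemH2 L f)
    (h1 : ZeroAtLateral L f) (h2 : ZeroAtTopBottom L (dz L f)) (j k : ℕ) :
    inner ℝ (lap L f) (ofCont L (sinCos L j k)) =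
      -gam L j k ^ 2 * inner ℝ f (ofCont L (sinCos L j k)) := by
  obtain ⟨⟨-, hz⟩, ⟨hxx, -⟩, -⟩ := hf
  have dsc := fderiv_separated Real.hasDerivAt_sin hasDerivAt_cos (wavenum L j) (k * Real.pi)
  have dcc := fderiv_separated hasDerivAt_cos hasDerivAt_cos (wavenum L j) (k * Real.pi)
  have dss := fderiv_separated Real.hasDerivAt_sin Real.hasDerivAt_sin (wavenum L j) (k * Real.pi)
  have a1 := (isWeakDeriv_weakDeriv hxx).integral_eq_of_lateral
    (φ := fun p => Real.sin (wavenum L j * p.1) * Real.cos (k * Real.pi * p.2)) (by fun_prop)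
    (fun p hp => (lateral_bounds hL j (fun _ => Real.abs_cos_le_one _) hp).1)
    (fun p hp => (lateral_bounds hL j (fun _ => Real.abs_cos_le_one _) hp).2)
  have a2 := h1 (fun p => Real.cos (wavenum L j * p.1) * Real.cos (k * Real.pi * p.2))
    (by fun_prop)
  have b1 := h2 (fun p => Real.sin (wavenum L j * p.1) * Real.cos (k * Real.pi * p.2))
    (by fun_prop)
  have b2 := (isWeakDeriv_weakDeriv hz).integral_eq_of_topBottom
    (φ := fun p => Real.sin (wavenum L j * p.1) * Real.sin (k * Real.pi * p.2)) (by fun_prop)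
    (fun p hp => (topBottom_bounds k (F := fun x => Real.sin (wavenum L j * x))
      (fun _ => Real.abs_sin_le_one _) hp).1)
    (fun p hp => (topBottom_bounds k (F := fun x => Real.sin (wavenum L j * x))
      (fun _ => Real.abs_sin_le_one _) hp).2)
  simp only [dsc, dcc, dss, integral_mul_const_mul, neg_mul, mul_neg, integral_neg]
    at a1 a2 b1 b2
  rw [inner_ofCont, inner_ofCont, integral_lap_mul _ (ContinuousMap.continuous _), gam_sq]
  simp only [sinCos, ContinuousMap.coe_mk]
  linear_combination a1 - wavenum L j * a2 + b1 + k * Real.pi * b2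

/-- As for `inner_lap_sinCos`, with the roles of the two directions exchanged. -/
theorem inner_lap_cosSin {L : ℝ} (hL : 0 < L) {f : L2 L} (hf : MemH2 L f)
    (h1 : ZeroAtLateral L (dx L f)) (h2 : ZeroAtTopBottom L f) (j k : ℕ) :
    inner ℝ (lap L f) (ofCont L (cosSin L j k)) =
      -gam L j k ^ 2 * inner ℝ f (ofCont L (cosSin L j k)) := by
  obtain ⟨⟨hx, -⟩, -, ⟨-, hzz⟩⟩ := hf
  have dcs := fderiv_separated hasDerivAt_cos Real.hasDerivAt_sin (wavenum L j) (k * Real.pi)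
  have dcc := fderiv_separated hasDerivAt_cos hasDerivAt_cos (wavenum L j) (k * Real.pi)
  have dss := fderiv_separated Real.hasDerivAt_sin Real.hasDerivAt_sin (wavenum L j) (k * Real.pi)
  have a1 := h1 (fun p => Real.cos (wavenum L j * p.1) * Real.sin (k * Real.pi * p.2))
    (by fun_prop)
  have a2 := (isWeakDeriv_weakDeriv hx).integral_eq_of_lateral
    (φ := fun p => Real.sin (wavenum L j * p.1) * Real.sin (k * Real.pi * p.2)) (by fun_prop)
    (fun p hp => (lateral_bounds hL j (fun _ => Real.abs_sin_le_one _) hp).1)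
    (fun p hp => (lateral_bounds hL j (fun _ => Real.abs_sin_le_one _) hp).2)
  have b1 := (isWeakDeriv_weakDeriv hzz).integral_eq_of_topBottom
    (φ := fun p => Real.cos (wavenum L j * p.1) * Real.sin (k * Real.pi * p.2)) (by fun_prop)
    (fun p hp => (topBottom_bounds k (F := fun x => Real.cos (wavenum L j * x))
      (fun _ => Real.abs_cos_le_one _) hp).1)
    (fun p hp => (topBottom_bounds k (F := fun x => Real.cos (wavenum L j * x))
      (fun _ => Real.abs_cos_le_one _) hp).2)
  have b2 := h2 (fun p => Real.cos (wavenum L j * p.1) * Real.cos (k * Real.pi * p.2))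
    (by fun_prop)
  simp only [dcs, dcc, dss, integral_mul_const_mul, neg_mul, mul_neg, integral_neg]
    at a1 a2 b1 b2
  rw [inner_ofCont, inner_ofCont, integral_lap_mul _ (ContinuousMap.continuous _), gam_sq]
  simp only [cosSin, ContinuousMap.coe_mk]
  linear_combination a1 + wavenum L j * a2 + b1 - k * Real.pi * b2

/-! ### Trigonometric states -/

/-- The velocity `(a sin(α_j x) cos(kπz), b cos(α_j x) sin(kπz))`. -/
noncomputable def trigVelocity (L a b : ℝ) (j k : ℕ) : Velocity L :=
  WithLp.toLp 2 ![a • ofCont L (sinCos L j k), b • ofCont L (cosSin L j k)]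

/-- The state `(a sin(α_j x) cos(kπz), b cos(α_j x) sin(kπz), c cos(α_j x) sin(kπz))`. -/
noncomputable def trigState (L a b c : ℝ) (j k : ℕ) : State L :=
  WithLp.toLp 2 ![a • ofCont L (sinCos L j k), b • ofCont L (cosSin L j k),
    c • ofCont L (cosSin L j k)]

theorem smul_trigState (L r a b c : ℝ) (j k : ℕ) :
    r • trigState L a b c j k = trigState L (r * a) (r * b) (r * c) j k := by
  ext1 i
  fin_cases i <;> simp [trigState, smul_smul]

theorem restrict_domain_eq (L : ℝ) : volume.restrict (domain L) =
    volume.restrict (Set.Icc ((0 : ℝ), (0 : ℝ)) (L, 1)) := by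
  rw [domain, ← Set.Icc_prod_Icc, Measure.volume_eq_prod, ← Measure.prod_restrict,
    ← Measure.prod_restrict, Measure.restrict_congr_set Ioo_ae_eq_Icc,
    Measure.restrict_congr_set Ioo_ae_eq_Icc]

/-- The divergence theorem for `φ` times the field: the normal component vanishes on all four sides,
and `h` says that the field has zero divergence. -/
theorem trigVelocity_mem_solenoidal {L : ℝ} (hL : 0 < L) {a b : ℝ} {j k : ℕ}
    (h : a * wavenum L j + b * (k * Real.pi) = 0) :
    trigVelocity L a b j k ∈ solenoidal L := by
  intro φ hφ
  have dsc := fderiv_separated Real.hasDerivAt_sin hasDerivAt_cos (wavenum L j) (k * Real.pi)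
  have dcs := fderiv_separated hasDerivAt_cos Real.hasDerivAt_sin (wavenum L j) (k * Real.pi)
  have hsc : ContDiff ℝ ∞ fun p : ℝ × ℝ =>
      Real.sin (wavenum L j * p.1) * Real.cos (k * Real.pi * p.2) := by fun_prop
  have hcs : ContDiff ℝ ∞ fun p : ℝ × ℝ =>
      Real.cos (wavenum L j * p.1) * Real.sin (k * Real.pi * p.2) := by fun_prop
  have hf : ContDiff ℝ ∞ fun p => a * (φ p * sinCos L j k p) :=
    contDiff_const.mul (hφ.mul hsc)
  have hg : ContDiff ℝ ∞ fun p => b * (φ p * cosSin L j k p) :=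
    contDiff_const.mul (hφ.mul hcs)
  have hφd : Differentiable ℝ φ := hφ.differentiable (by simp)
  have key : ∀ p, fderiv ℝ (fun p => a * (φ p * sinCos L j k p)) p (1, 0) +
      fderiv ℝ (fun p => b * (φ p * cosSin L j k p)) p (0, 1) =
      a * (sinCos L j k p * fderiv ℝ φ p (1, 0)) + b * (cosSin L j k p * fderiv ℝ φ p (0, 1)) := by
    intro p
    have e1 : fderiv ℝ (sinCos L j k) p (1, 0) = wavenum L j *
      (Real.cos (wavenum L j * p.1) * Real.cos (k * Real.pi * p.2)) := (dsc p).1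
    have e2 : fderiv ℝ (cosSin L j k) p (0, 1) = k * Real.pi *
      (Real.cos (wavenum L j * p.1) * Real.cos (k * Real.pi * p.2)) := (dcs p).2
    have hsc' : DifferentiableAt ℝ (sinCos L j k) p := hsc.differentiable (by simp) p
    have hcs' : DifferentiableAt ℝ (cosSin L j k) p := hcs.differentiable (by simp) p
    rw [fderiv_const_mul ((hφd p).fun_mul hsc'), fderiv_fun_mul (hφd p) hsc',
      fderiv_const_mul ((hφd p).fun_mul hcs'), fderiv_fun_mul (hφd p) hcs']
    simp only [smul_apply, add_apply, smul_eq_mul, e1, e2]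
    linear_combination (φ p * (Real.cos (wavenum L j * p.1) * Real.cos (k * Real.pi * p.2))) * h
  have hdiv := integral_divergence_prod_Icc_of_hasFDerivAt_of_le
    (fun p => a * (φ p * sinCos L j k p)) (fun p => b * (φ p * cosSin L j k p))
    (fderiv ℝ fun p => a * (φ p * sinCos L j k p)) (fderiv ℝ fun p => b * (φ p * cosSin L j k p))
    ((0 : ℝ), (0 : ℝ)) (L, 1) ⟨hL.le, zero_le_one⟩ hf.continuous.continuousOn
    hg.continuous.continuousOn
    (fun p _ => (hf.differentiable (by simp) p).hasFDerivAt)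
    (fun p _ => (hg.differentiable (by simp) p).hasFDerivAt)
    (((continuous_fderiv_apply_of_smooth hf _).add
      (continuous_fderiv_apply_of_smooth hg _)).continuousOn.integrableOn_compact isCompact_Icc)
  have hz0 : ∀ x, cosSin L j k (x, 0) = 0 := by simp [cosSin]
  have hz1 : ∀ x, cosSin L j k (x, 1) = 0 := by simp [cosSin]
  have hx0 : ∀ z, sinCos L j k (0, z) = 0 := by simp [sinCos]
  have hx1 : ∀ z, sinCos L j k (L, z) = 0 := by simp [sinCos, wavenum_mul hL]
  simp only [hz0, hz1, hx0, hx1, mul_zero, intervalIntegral.integral_zero, sub_zero, add_zero,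
    key] at hdiv
  rw [← restrict_domain_eq] at hdiv
  have hcont : ∀ (g : C(ℝ × ℝ, ℝ)) (e : ℝ × ℝ),
      Integrable (fun p => g p * fderiv ℝ φ p e) (volume.restrict (domain L)) := fun g e =>
    (memLp_of_continuous L g.continuous).integrable_mul
      (memLp_of_continuous L (continuous_fderiv_apply_of_smooth hφ e))
  rw [integral_add ((hcont _ _).const_mul a) ((hcont _ _).const_mul b), integral_const_mul,
    integral_const_mul] at hdiv
  have hsm : ∀ (r : ℝ) (g : C(ℝ × ℝ, ℝ)) (e : ℝ × ℝ),
      ∫ p in domain L, (r • ofCont L g : L2 L) p * fderiv ℝ φ p e =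
        r * ∫ p in domain L, g p * fderiv ℝ φ p e := by
    intro r g e
    rw [← integral_ofCont_mul, ← integral_const_mul]
    refine integral_congr_ae ?_
    filter_upwards [Lp.coeFn_smul r (ofCont L g)] with p hp
    rw [hp, Pi.smul_apply, smul_eq_mul, mul_assoc]
  simp only [trigVelocity, Matrix.cons_val_zero, Matrix.cons_val_one]
  rw [hsm, hsm]
  exact hdiv

/-- The test function is `cos(α_j x) cos(kπz)`, whose gradient is made of the two profiles. -/
theorem solenoidal_pairing {L : ℝ} {v : Velocity L} (hv : v ∈ solenoidal L) (j k : ℕ) :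
    wavenum L j * inner ℝ (v 0) (ofCont L (sinCos L j k)) +
      k * Real.pi * inner ℝ (v 1) (ofCont L (cosSin L j k)) = 0 := by
  have dcc := fderiv_separated hasDerivAt_cos hasDerivAt_cos (wavenum L j) (k * Real.pi)
  have h := hv (fun p => Real.cos (wavenum L j * p.1) * Real.cos (k * Real.pi * p.2))
    (by fun_prop)
  simp only [dcc, integral_mul_const_mul, neg_mul, mul_neg, integral_neg] at h
  rw [inner_ofCont, inner_ofCont]
  simp only [sinCos, cosSin, ContinuousMap.coe_mk]
  linarith

theorem gam_pos (L : ℝ) (j : ℕ) {k : ℕ} (hk : 1 ≤ k) : 0 < gam L j k := by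
  have : (0 : ℝ) < k := by exact_mod_cast hk
  unfold gam
  positivity

/-- The force minus its claimed projection is a multiple of the gradient of `cos(α_j x) cos(kπz)`,
hence orthogonal to the solenoidal fields by `solenoidal_pairing`. -/
theorem leray_buoyancy {L : ℝ} (hL : 0 < L) (c : ℝ) (j : ℕ) {k : ℕ} (hk : 1 ≤ k) :
    leray L (WithLp.toLp 2 ![0, c • ofCont L (cosSin L j k)]) =
      trigVelocity L (-(c * wavenum L j * (k * Real.pi) / gam L j k ^ 2))
        (c * wavenum L j ^ 2 / gam L j k ^ 2) j k := by
  have hg := gam_pos L j hk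
  have hg2 := gam_sq L j k
  refine Submodule.eq_starProjection_of_mem_of_inner_eq_zero
    (trigVelocity_mem_solenoidal hL (by ring)) fun v hv => ?_
  have h := solenoidal_pairing hv j k
  rw [real_inner_comm (ofCont L (sinCos L j k)), real_inner_comm (ofCont L (cosSin L j k))] at h
  simp only [trigVelocity, PiLp.inner_apply, Fin.sum_univ_two,
    Matrix.cons_val_zero, Matrix.cons_val_one, inner_sub_left, inner_smul_left, inner_zero_left,
    conj_trivial]
  field_simp
  rw [hg2]
  linear_combination (c * k * Real.pi) * h

theorem opP_trigState {L : ℝ} (hL : 0 < L) (Ra a b c : ℝ) (j : ℕ) {k : ℕ} (hk : 1 ≤ k) :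
    opP L Ra (trigState L a b c j k) =
      trigState L (-(√Ra * c * wavenum L j * (k * Real.pi) / gam L j k ^ 2))
        (√Ra * c * wavenum L j ^ 2 / gam L j k ^ 2) (√Ra * b) j k := by
  have h := leray_buoyancy hL c j hk
  unfold opP
  have h2 : trigState L a b c j k 2 = c • ofCont L (cosSin L j k) := rfl
  have h1 : trigState L a b c j k 1 = b • ofCont L (cosSin L j k) := rfl
  rw [h2, h1, h]
  ext1 i
  fin_cases i
  · simp only [trigState, trigVelocity, Fin.zero_eta, Matrix.cons_val_zero, smul_smul]
    congr 1
    ring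
  · simp only [trigState, trigVelocity, Fin.mk_one, Matrix.cons_val_one, Matrix.cons_val_zero,
      smul_smul]
    congr 1
    ring
  · simp [trigState, smul_smul]

/-- On all of `(L²)³` the formula for `P_Ra` is not symmetric, because `w` enters unprojected; the
adjoint moves the Leray projection onto the velocity of `y`. -/
theorem exists_inner_opP_eq (L Ra : ℝ) (y : State L) :
    ∃ y', ∀ x, inner ℝ (opP L Ra x) y = inner ℝ x y' := by
  refine ⟨WithLp.toLp 2 ![0, √Ra • y 2, √Ra • leray L (WithLp.toLp 2 ![y 0, y 1]) 1], fun x => ?_⟩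
  have h : inner ℝ (leray L (WithLp.toLp 2 ![0, x 2])) (WithLp.toLp 2 ![y 0, y 1] : Velocity L) =
      inner ℝ (WithLp.toLp 2 ![0, x 2] : Velocity L) (leray L (WithLp.toLp 2 ![y 0, y 1])) :=
    Submodule.inner_starProjection_left_eq_right _ _ _
  simp [PiLp.inner_apply, Fin.sum_univ_two, Fin.sum_univ_three, opP, inner_smul_left,
    inner_smul_right] at h ⊢
  linear_combination √Ra * h

/-- The Leray projection is self-adjoint and fixes the solenoidal trigonometric velocity, so it
disappears and the Laplacian is tested component by component. -/
theorem inner_opA_trigState {L : ℝ} (hL : 0 < L) {ψ : State L} (hψ : MemDomain L ψ)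
    {a b c : ℝ} {j k : ℕ} (h : a * wavenum L j + b * (k * Real.pi) = 0) :
    inner ℝ (opA L ψ) (trigState L a b c j k) =
      gam L j k ^ 2 * inner ℝ ψ (trigState L a b c j k) := by
  have hu := inner_lap_sinCos hL (hψ.memH2 0) hψ.u_lateral hψ.dz_u_topBottom j k
  have hw := inner_lap_cosSin hL (hψ.memH2 1) hψ.dx_w_lateral hψ.w_topBottom j k
  have hθ := inner_lap_cosSin hL (hψ.memH2 2) hψ.dx_θ_lateral hψ.θ_topBottom j k
  have hv : inner ℝ (leray L (WithLp.toLp 2 ![lap L (ψ 0), lap L (ψ 1)]))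
      (trigVelocity L a b j k) =
      inner ℝ (WithLp.toLp 2 ![lap L (ψ 0), lap L (ψ 1)] : Velocity L)
        (trigVelocity L a b j k) := by
    unfold leray
    rw [Submodule.inner_starProjection_left_eq_right,
      Submodule.starProjection_eq_self_iff.2 (trigVelocity_mem_solenoidal hL h)]
  simp only [PiLp.inner_apply, Fin.sum_univ_two, Fin.sum_univ_three, trigVelocity, trigState, opA,
    Matrix.cons_val_zero, Matrix.cons_val_one, Matrix.cons_val, inner_smul_right,
    inner_neg_left] at hv ⊢
  linear_combination -hv - a * hu - b * hw - c * hθ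

/-! ### Orthogonality relations -/

theorem integral_cos_mul_Ioo {T c : ℝ} (hT : 0 < T) {m : ℤ} (hm : c * T = m * Real.pi) :
    ∫ x in Set.Ioo 0 T, Real.cos (c * x) = if m = 0 then T else 0 := by
  rw [← integral_Ioc_eq_integral_Ioo, ← intervalIntegral.integral_of_le hT.le]
  split_ifs with h
  · have hc : c = 0 := by
      rw [h, Int.cast_zero, zero_mul] at hm
      exact (mul_eq_zero.1 hm).resolve_right hT.ne'
    simp [hc]
  · have hc : c ≠ 0 := by
      rintro rfl
      rw [zero_mul, eq_comm, mul_eq_zero] at hm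
      rcases hm with hm | hm
      · exact h (by exact_mod_cast hm)
      · exact Real.pi_ne_zero hm
    rw [intervalIntegral.integral_comp_mul_left _ hc, integral_cos, hm]
    simp [Real.sin_int_mul_pi]

theorem integral_cos_mul_cos_Ioo {T a b : ℝ} (hT : 0 < T) {m n : ℕ} (hm : a * T = m * Real.pi)
    (hn : b * T = n * Real.pi) :
    ∫ x in Set.Ioo 0 T, Real.cos (a * x) * Real.cos (b * x) =
      if m = n then (if m = 0 then T else T / 2) else 0 := by
  have hi : ∀ c : ℝ, Integrable (fun x => Real.cos (c * x)) (volume.restrict (Set.Ioo 0 T)) :=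
    fun c => ((by fun_prop : Continuous fun x => Real.cos (c * x)).integrableOn_Icc).mono_set
      Set.Ioo_subset_Icc_self
  have h : ∀ x, Real.cos (a * x) * Real.cos (b * x) =
      1 / 2 * (Real.cos ((a - b) * x) + Real.cos ((a + b) * x)) := by
    intro x
    rw [sub_mul, add_mul, Real.cos_sub, Real.cos_add]
    ring
  simp only [h]
  rw [integral_const_mul, integral_add (hi _) (hi _),
    integral_cos_mul_Ioo hT (m := m - n) (by push_cast; linarith),
    integral_cos_mul_Ioo hT (m := m + n) (by push_cast; linarith)]
  split_ifs <;> first | omega | ring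

theorem integral_sin_mul_sin_Ioo {T a b : ℝ} (hT : 0 < T) {m n : ℕ} (hm : a * T = m * Real.pi)
    (hn : b * T = n * Real.pi) :
    ∫ x in Set.Ioo 0 T, Real.sin (a * x) * Real.sin (b * x) =
      if m = n then (if m = 0 then 0 else T / 2) else 0 := by
  have hi : ∀ c : ℝ, Integrable (fun x => Real.cos (c * x)) (volume.restrict (Set.Ioo 0 T)) :=
    fun c => ((by fun_prop : Continuous fun x => Real.cos (c * x)).integrableOn_Icc).mono_set
      Set.Ioo_subset_Icc_self
  have h : ∀ x, Real.sin (a * x) * Real.sin (b * x) =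
      1 / 2 * (Real.cos ((a - b) * x) - Real.cos ((a + b) * x)) := by
    intro x
    rw [sub_mul, add_mul, Real.cos_sub, Real.cos_add]
    ring
  simp only [h]
  rw [integral_const_mul, integral_sub (hi _) (hi _),
    integral_cos_mul_Ioo hT (m := m - n) (by push_cast; linarith),
    integral_cos_mul_Ioo hT (m := m + n) (by push_cast; linarith)]
  split_ifs <;> first | omega | ring

theorem inner_sinCos {L : ℝ} (hL : 0 < L) (j j' : ℕ) {k k' : ℕ} (hk : 1 ≤ k) :
    inner ℝ (ofCont L (sinCos L j k)) (ofCont L (sinCos L j' k')) =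
      (if j = j' then (if j = 0 then 0 else L / 2) else 0) * if k = k' then 1 / 2 else 0 := by
  rw [inner_ofCont, integral_ofCont_mul]
  have h : ∀ p, sinCos L j k p * sinCos L j' k' p =
      (Real.sin (wavenum L j * p.1) * Real.sin (wavenum L j' * p.1)) *
        (Real.cos (k * Real.pi * p.2) * Real.cos (k' * Real.pi * p.2)) := fun p => by
    simp only [sinCos, ContinuousMap.coe_mk]
    ring
  simp only [h]
  rw [domain, Measure.volume_eq_prod,
    setIntegral_prod_mul (fun x => Real.sin (wavenum L j * x) * Real.sin (wavenum L j' * x))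
      (fun z => Real.cos (k * Real.pi * z) * Real.cos (k' * Real.pi * z)),
    integral_sin_mul_sin_Ioo hL (wavenum_mul hL j) (wavenum_mul hL j'),
    integral_cos_mul_cos_Ioo one_pos (mul_one _) (mul_one _), if_neg (show k ≠ 0 by omega)]

theorem inner_cosSin {L : ℝ} (hL : 0 < L) (j j' : ℕ) {k k' : ℕ} (hk : 1 ≤ k) :
    inner ℝ (ofCont L (cosSin L j k)) (ofCont L (cosSin L j' k')) =
      (if j = j' then (if j = 0 then L else L / 2) else 0) * if k = k' then 1 / 2 else 0 := by
  rw [inner_ofCont, integral_ofCont_mul]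
  have h : ∀ p, cosSin L j k p * cosSin L j' k' p =
      (Real.cos (wavenum L j * p.1) * Real.cos (wavenum L j' * p.1)) *
        (Real.sin (k * Real.pi * p.2) * Real.sin (k' * Real.pi * p.2)) := fun p => by
    simp only [cosSin, ContinuousMap.coe_mk]
    ring
  simp only [h]
  rw [domain, Measure.volume_eq_prod,
    setIntegral_prod_mul (fun x => Real.cos (wavenum L j * x) * Real.cos (wavenum L j' * x))
      (fun z => Real.sin (k * Real.pi * z) * Real.sin (k' * Real.pi * z)),
    integral_cos_mul_cos_Ioo hL (wavenum_mul hL j) (wavenum_mul hL j'),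
    integral_sin_mul_sin_Ioo one_pos (mul_one _) (mul_one _), if_neg (show k ≠ 0 by omega)]

theorem inner_trigState {L : ℝ} (hL : 0 < L) (a b c a' b' c' : ℝ) (j j' : ℕ) {k k' : ℕ}
    (hk : 1 ≤ k) : inner ℝ (trigState L a b c j k) (trigState L a' b' c' j' k') =
      if j = j' ∧ k = k' then
        (if j = 0 then L / 2 * (b * b' + c * c') else L / 4 * (a * a' + b * b' + c * c')) else 0 := by
  simp only [PiLp.inner_apply, Fin.sum_univ_three, trigState, Matrix.cons_val_zero,
    Matrix.cons_val_one, Matrix.cons_val, inner_smul_left, inner_smul_right, conj_trivial,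
    inner_sinCos hL _ _ hk, inner_cosSin hL _ _ hk]
  split_ifs <;> first | omega | (simp_all; done) | ring

/-! ### The eigenmodes -/

/-- This quantity is also the eigenvalue of `P_Ra` on the mode. -/
theorem gam_sq_add_eigenvalue {L Ra : ℝ} (hL : 0 < L) (s : ℝ) {j k : ℕ} (hk : 1 ≤ k) :
    gam L j k ^ 2 + eigenvalue L Ra s j k = s * (√Ra * wavenum L j / gam L j k) := by
  have hg := gam_pos L j hk
  rw [eigenvalue, add_neg_cancel_left, Real.sqrt_div' _ (by positivity), Real.sqrt_sq hg.le,
    Real.sqrt_mul' _ (by positivity), Real.sqrt_sq (wavenum_nonneg hL j)]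

/-- The two summands in the denominator, `γ² (γ² + β)²` and `Ra α²`, are equal, so the constant
depends neither on `Ra` nor on the sign. -/
theorem normalization_eq {L Ra s : ℝ} (hL : 0 < L) (hRa : 0 < Ra) (hs : s ^ 2 = 1) {j k : ℕ}
    (hj : 1 ≤ j) (hk : 1 ≤ k) : normalization L Ra s j k = √(2 / L) / gam L j k := by
  have hg := gam_pos L j hk
  have hw := wavenum_pos hL hj
  have hR : √Ra ^ 2 = Ra := Real.sq_sqrt hRa.le
  rw [normalization, gam_sq_add_eigenvalue hL s hk, ← Real.sqrt_sq hg.le, ← Real.sqrt_div' _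
    (by positivity), Real.sqrt_sq hg.le]
  congr 1
  rw [mul_pow, div_pow, mul_pow, hs, hR]
  field_simp
  ring

/-- The mode of wave vector `(j, k)` and sign `s` with its normalization made explicit. -/
theorem mode_eq {L Ra s : ℝ} (hL : 0 < L) (hRa : 0 < Ra) (hs : s ^ 2 = 1) {j k : ℕ}
    (hj : 1 ≤ j) (hk : 1 ≤ k) : mode L Ra s j k =
      trigState L (-(k * Real.pi * (√(2 / L) / gam L j k)))
        (wavenum L j * (√(2 / L) / gam L j k)) (s * √(2 / L)) j k := by
  have hg := gam_pos L j hk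
  have hw := wavenum_pos hL hj
  have hR : 0 < √Ra := Real.sqrt_pos.2 hRa
  have hs0 : s ≠ 0 := by
    rintro rfl
    norm_num at hs
  have hc : √Ra * wavenum L j / (gam L j k ^ 2 + eigenvalue L Ra s j k) *
      normalization L Ra s j k = s * √(2 / L) := by
    rw [gam_sq_add_eigenvalue hL s hk, normalization_eq hL hRa hs hj hk]
    field_simp
    exact hs.symm
  rw [← hc, ← normalization_eq hL hRa hs hj hk, mode, trigState]
  congr 1

/-- The modes of group one are the case `j = 0` of the trigonometric states, since `cos(α_0 x) = 1`;
both groups can then be treated alike. -/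
theorem mode0_eq (L : ℝ) (k : ℕ) : mode0 L k = trigState L 0 0 √(2 / L) 0 k := by
  rw [mode0, trigState]
  congr 1
  funext i
  fin_cases i
  · simp
  · simp
  · exact ofCont_const_mul _ _ _ _ fun p => by simp [cosSin, wavenum]

/-- The wave vectors `(0, k)` and, with a sign, `(j, k)`, for `j, k ≥ 1`. -/
abbrev ModeIndex : Type := ℕ ⊕ (ℕ × ℕ × Bool)

/-- The eigenmodes, as a family. -/
noncomputable def modeFamily (L Ra : ℝ) : ModeIndex → State L
  | .inl k => mode0 L (k + 1)
  | .inr (j, k, s) => mode L Ra (if s then 1 else -1) (j + 1) (k + 1)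

theorem sign_sq (s : Bool) : (if s then (1 : ℝ) else -1) ^ 2 = 1 := by
  cases s <;> norm_num

theorem orthonormal_modeFamily {L Ra : ℝ} (hL : 0 < L) (hRa : 0 < Ra) :
    Orthonormal ℝ (modeFamily L Ra) := by
  have hr : √(2 / L) ^ 2 = 2 / L := Real.sq_sqrt (by positivity)
  rw [orthonormal_iff_ite]
  rintro (k | ⟨j, k, s⟩) (k' | ⟨j', k', s'⟩)
  · simp only [modeFamily, mode0_eq, inner_trigState hL _ _ _ _ _ _ _ _ (Nat.succ_pos k), ↓reduceIte]
    by_cases h : k = k'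
    · rw [if_pos (by simp [h]), if_pos (by rw [h]), mul_zero, zero_add, ← sq, hr]
      field_simp
    · rw [if_neg (by simp [h]), if_neg (by simp [h])]
  · simp only [modeFamily]
    rw [mode0_eq, mode_eq hL hRa (sign_sq s') (Nat.succ_pos j') (Nat.succ_pos k'),
      inner_trigState hL _ _ _ _ _ _ _ _ (Nat.succ_pos k), if_neg (by simp), if_neg (by simp)]
  · simp only [modeFamily]
    rw [mode0_eq, mode_eq hL hRa (sign_sq s) (Nat.succ_pos j) (Nat.succ_pos k),
      inner_trigState hL _ _ _ _ _ _ _ _ (Nat.succ_pos k), if_neg (by simp), if_neg (by simp)]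
  · simp only [modeFamily]
    rw [mode_eq hL hRa (sign_sq s) (Nat.succ_pos j) (Nat.succ_pos k),
      mode_eq hL hRa (sign_sq s') (Nat.succ_pos j') (Nat.succ_pos k'),
      inner_trigState hL _ _ _ _ _ _ _ _ (Nat.succ_pos k)]
    by_cases h : j = j' ∧ k = k'
    · obtain ⟨rfl, rfl⟩ := h
      have hg := gam_pos L (j + 1) (Nat.succ_pos k)
      have hg2 := gam_sq L (j + 1) (k + 1)
      rw [if_pos ⟨rfl, rfl⟩, if_neg (Nat.succ_ne_zero j)]
      -- Velocity and temperature carry equal weight: they contribute `1/2` and `στ/2`. Hence modes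
      -- with opposite signs are orthogonal.
      have e : ∀ σ τ : ℝ, L / 4 * (-((k + 1 : ℕ) * Real.pi * (√(2 / L) / gam L (j + 1) (k + 1))) *
          -((k + 1 : ℕ) * Real.pi * (√(2 / L) / gam L (j + 1) (k + 1))) +
          wavenum L (j + 1) * (√(2 / L) / gam L (j + 1) (k + 1)) *
          (wavenum L (j + 1) * (√(2 / L) / gam L (j + 1) (k + 1))) +
          σ * √(2 / L) * (τ * √(2 / L))) = (1 + σ * τ) / 2 := by
        intro σ τ
        calc _ = L / 4 * (√(2 / L) ^ 2 * ((wavenum L (j + 1) ^ 2 +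
              ((k + 1 : ℕ) : ℝ) ^ 2 * Real.pi ^ 2) / gam L (j + 1) (k + 1) ^ 2 + σ * τ)) := by
              field_simp
              ring
          _ = _ := by
              rw [← hg2, hr]
              field_simp
              ring
      rw [e]
      cases s <;> cases s' <;> norm_num
    · rw [if_neg (by simpa using h), if_neg (by simp only [Sum.inr.injEq, Prod.mk.injEq]; tauto)]

/-- The eigenvalues `γ_jk²` of `A`. -/
noncomputable def rateA (L : ℝ) : ModeIndex → ℝ
  | .inl k => gam L 0 (k + 1) ^ 2
  | .inr (j, k, _) => gam L (j + 1) (k + 1) ^ 2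

/-- The eigenvalues `0` and `±√Ra α_j / γ_jk` of `P_Ra`. -/
noncomputable def rateP (L Ra : ℝ) : ModeIndex → ℝ
  | .inl _ => 0
  | .inr (j, k, s) => (if s then 1 else -1) * (√Ra * wavenum L (j + 1) / gam L (j + 1) (k + 1))

theorem opP_modeFamily {L Ra : ℝ} (hL : 0 < L) (hRa : 0 < Ra) (i : ModeIndex) :
    opP L Ra (modeFamily L Ra i) = rateP L Ra i • modeFamily L Ra i := by
  rcases i with k | ⟨j, k, s⟩
  · simp only [modeFamily, rateP]
    rw [mode0_eq, opP_trigState hL _ _ _ _ _ (Nat.succ_pos k), smul_trigState]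
    simp [wavenum]
  · simp only [modeFamily, rateP]
    have hs := sign_sq s
    have hg := gam_pos L (j + 1) (Nat.succ_pos k)
    rw [mode_eq hL hRa hs (Nat.succ_pos j) (Nat.succ_pos k),
      opP_trigState hL _ _ _ _ _ (Nat.succ_pos k), smul_trigState]
    generalize (if s then (1 : ℝ) else -1) = σ at hs
    congr 1
    · field_simp
    · field_simp
    · rw [show σ * (√Ra * wavenum L (j + 1) / gam L (j + 1) (k + 1)) * (σ * √(2 / L)) =
        σ ^ 2 * (√Ra * wavenum L (j + 1) / gam L (j + 1) (k + 1)) * √(2 / L) by ring, hs]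
      ring

theorem inner_opA_modeFamily {L Ra : ℝ} (hL : 0 < L) (hRa : 0 < Ra) {ψ : State L}
    (hψ : MemDomain L ψ) (i : ModeIndex) :
    inner ℝ (opA L ψ) (modeFamily L Ra i) = rateA L i * inner ℝ ψ (modeFamily L Ra i) := by
  rcases i with k | ⟨j, k, s⟩
  · simp only [modeFamily, rateA]
    rw [mode0_eq, inner_opA_trigState hL hψ (by ring)]
  · simp only [modeFamily, rateA]
    rw [mode_eq hL hRa (sign_sq s) (Nat.succ_pos j) (Nat.succ_pos k),
      inner_opA_trigState hL hψ (by ring)]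

/-- Indices are shifted by one, so `(jc - 1, 0, true)` stands for the critical mode with wave vector
`(jc, 1)` and sign `+`. -/
theorem stableModes_subset_range {L Ra : ℝ} {jc : ℕ} (hjc : 1 ≤ jc) :
    stableModes L Ra jc ⊆ Set.range fun i : {i : ModeIndex // i ≠ .inr (jc - 1, 0, true)} =>
      modeFamily L Ra i := by
  rintro ψ ((⟨k, hk, rfl⟩ | ⟨j, k, hj, hk, rfl⟩) | ⟨j, k, hj, hk, hne, rfl⟩)
  · refine ⟨⟨.inl (k - 1), by simp⟩, ?_⟩
    simp [modeFamily, Nat.sub_add_cancel hk]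
  · refine ⟨⟨.inr (j - 1, k - 1, false), by simp⟩, ?_⟩
    simp [modeFamily, Nat.sub_add_cancel hk, Nat.sub_add_cancel hj]
  · refine ⟨⟨.inr (j - 1, k - 1, true), ?_⟩, ?_⟩
    · simp only [ne_eq, Sum.inr.injEq, Prod.mk.injEq, and_true] at hne ⊢
      omega
    · simp [modeFamily, Nat.sub_add_cancel hk, Nat.sub_add_cancel hj]

/-! ### The bound on the rates and the estimates on the stable subspace -/

theorem pi_sq_le_gam_sq (L : ℝ) (j k : ℕ) : Real.pi ^ 2 ≤ gam L j (k + 1) ^ 2 := by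
  rw [gam_sq]
  have : (1 : ℝ) * Real.pi ^ 2 ≤ ((k + 1 : ℕ) : ℝ) ^ 2 * Real.pi ^ 2 := by
    gcongr
    push_cast
    nlinarith [k.cast_nonneg (α := ℝ)]
  have := sq_nonneg (wavenum L j)
  linarith

theorem sqrt_marginalRa {L : ℝ} (hL : 0 < L) (j k : ℕ) :
    √(marginalRa L j k) = gam L j k ^ 3 / wavenum L j := by
  have hg : 0 ≤ gam L j k := Real.sqrt_nonneg _
  have hw := wavenum_nonneg hL j
  rw [marginalRa, show gam L j k ^ 6 / wavenum L j ^ 2 = (gam L j k ^ 3 / wavenum L j) ^ 2 by ring,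
    Real.sqrt_sq (by positivity)]

/-- Here `ρ` and `σ` are on the scale of square roots of Rayleigh numbers. The gap gives `√Ra α/γ ≤
γ² σ/ρ` for the stable `+` modes; for all other modes the eigenvalue of `P_Ra` is at most `0`, also
at the critical wave vector. What remains is `-γ² (η - σ/ρ)`, and `γ² ≥ π²`. -/
theorem rate_bound {L Ra η ρ σ : ℝ} (hL : 0 < L) {jc : ℕ} (hρ : 0 < ρ)
    (hRaσ : √Ra ≤ σ) (hσ : σ ≤ η * ρ)
    (hgap : ∀ j k : ℕ, 1 ≤ j → 1 ≤ k → (j, k) ≠ (jc, 1) → ρ ≤ √(marginalRa L j k))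
    {i : ModeIndex} (hi : i ≠ .inr (jc - 1, 0, true)) :
    -η * rateA L i + rateP L Ra i ≤ -(Real.pi ^ 2 * (η - σ / ρ)) := by
  have hpi := Real.pi_pos
  have hσ0 : 0 ≤ σ := (Real.sqrt_nonneg _).trans hRaσ
  have hq : 0 ≤ σ / ρ := by positivity
  have hq' : 0 ≤ η - σ / ρ := by rw [sub_nonneg, div_le_iff₀ hρ]; exact hσ
  have base : ∀ g p : ℝ, Real.pi ^ 2 ≤ g → p ≤ g * (σ / ρ) →
      -η * g + p ≤ -(Real.pi ^ 2 * (η - σ / ρ)) := by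
    intro g p hg hp
    have := mul_le_mul_of_nonneg_right hg hq'
    linarith
  rcases i with k | ⟨j, k, s⟩
  · simp only [rateA, rateP]
    exact base _ _ (pi_sq_le_gam_sq L 0 k) (by positivity)
  · simp only [rateA, rateP]
    refine base _ _ (pi_sq_le_gam_sq L (j + 1) k) ?_
    have hg := gam_pos L (j + 1) (Nat.succ_pos k)
    have hw := wavenum_pos hL (Nat.succ_pos j)
    cases s
    · have : 0 ≤ √Ra * wavenum L (j + 1) / gam L (j + 1) (k + 1) := by positivity
      have : 0 ≤ gam L (j + 1) (k + 1) ^ 2 * (σ / ρ) := by positivity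
      simp only [Bool.false_eq_true, if_false]
      linarith
    · have hne : (j + 1, k + 1) ≠ (jc, 1) := by
        simp only [ne_eq, Sum.inr.injEq, Prod.mk.injEq, and_true] at hi ⊢
        omega
      have h := hgap (j + 1) (k + 1) (Nat.succ_pos j) (Nat.succ_pos k) hne
      rw [sqrt_marginalRa hL, le_div_iff₀ hw] at h
      simp only [if_true, one_mul]
      rw [div_le_iff₀ hg, ← mul_div_assoc, div_mul_eq_mul_div, le_div_iff₀ hρ]
      calc √Ra * wavenum L (j + 1) * ρ ≤ σ * wavenum L (j + 1) * ρ := by gcongr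
        _ = σ * (ρ * wavenum L (j + 1)) := by ring
        _ ≤ σ * gam L (j + 1) (k + 1) ^ 3 := by gcongr
        _ = _ := by ring

theorem energy_estimates_of_mem_stableSubspace {L Ra η δ : ℝ} (hL : 0 < L) (hRa : 0 < Ra) {jc : ℕ}
    (hjc : 1 ≤ jc) (hη : 0 ≤ η)
    (hle : ∀ i : ModeIndex, i ≠ .inr (jc - 1, 0, true) → -η * rateA L i + rateP L Ra i ≤ -δ)
    {ψ : State L} (hψ : MemDomain L ψ) (hψs : ψ ∈ stableSubspace L Ra jc) :
    inner ℝ (-(η • opA L ψ) + opP L Ra ψ) ψ ≤ -δ * ‖ψ‖ ^ 2 ∧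
      inner ℝ (-(η • opA L ψ) + opP L Ra ψ) (opA L ψ) ≤ -δ * nuNorm L ψ ^ 2 := by
  have he := (orthonormal_modeFamily hL hRa).comp
    (Subtype.val : {i : ModeIndex // i ≠ .inr (jc - 1, 0, true)} → ModeIndex)
    Subtype.val_injective
  obtain ⟨h0, h1, h2⟩ := he.energy_estimates
    (Submodule.topologicalClosure_mono
      (Submodule.span_mono (stableModes_subset_range hjc)) hψs)
    (B := opP L Ra) (exists_inner_opP_eq L Ra) (fun i => opP_modeFamily hL hRa i)
    (fun i => inner_opA_modeFamily hL hRa hψ i)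
    (fun i => by rcases i with ⟨k | ⟨j, k, s⟩, hi⟩ <;> simp only [rateA] <;> positivity)
    hη (fun i => hle i i.2)
  refine ⟨h1, ?_⟩
  -- Without `0 ≤ ⟨Aψ, ψ⟩` the square root would be `0` by default and its square would not return
  -- the form.
  rwa [nuNorm, Real.sq_sqrt h0]

end RBC

theorem lemma5p1 (L : ℝ) (hL : 0 < L) (hLS : L ∉ RBC.exceptionalSet)
    (jc : ℕ) (hjc : 1 ≤ jc) (hcrit : RBC.marginalRa L jc 1 = RBC.Rac L) :
    ∃ η ∈ Set.Ioo (0 : ℝ) 1, ∃ δ > (0 : ℝ), ∃ RaStar > RBC.Rac L,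
      ∀ Ra ∈ Set.Icc (RBC.Rac L) RaStar, ∀ ψ : RBC.State L,
        RBC.MemDomain L ψ → ψ ∈ RBC.stableSubspace L Ra jc →
          inner ℝ (-(η • RBC.opA L ψ) + RBC.opP L Ra ψ) ψ ≤ -δ * ‖ψ‖ ^ 2 ∧
          inner ℝ (-(η • RBC.opA L ψ) + RBC.opP L Ra ψ) (RBC.opA L ψ)
            ≤ -δ * RBC.nuNorm L ψ ^ 2 := by
  have hRac : 0 < RBC.Rac L := by
    have := RBC.wavenum_pos hL hjc
    have := Real.pi_pos
    rw [← hcrit, RBC.marginalRa_eq, Nat.cast_one]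
    positivity
  obtain ⟨ρ, hρ, hgap⟩ := RBC.exists_gap hL hLS hjc hcrit
  -- `Ra* < ρ` makes `√Ra* / √ρ < 1`, which leaves room for `η < 1` and for a positive `δ`.
  obtain ⟨RaStar, hR1, hR2⟩ := exists_between hρ
  have hS0 : 0 < RaStar := hRac.trans hR1
  have hsρ : 0 < √ρ := Real.sqrt_pos.2 (hS0.trans hR2)
  have hsS : 0 < √RaStar := Real.sqrt_pos.2 hS0
  have hlt : √RaStar / √ρ < 1 := (div_lt_one hsρ).2 (Real.sqrt_lt_sqrt hS0.le hR2)
  obtain ⟨η, hη1, hη2⟩ := exists_between hlt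
  have hη0 : 0 < η := lt_trans (by positivity) hη1
  refine ⟨η, ⟨hη0, hη2⟩, Real.pi ^ 2 * (η - √RaStar / √ρ),
    mul_pos (by positivity) (sub_pos.2 hη1), RaStar, hR1, fun Ra hRa ψ hψ hψs => ?_⟩
  exact RBC.energy_estimates_of_mem_stableSubspace hL (hRac.trans_le hRa.1) hjc hη0.le
    (fun i hi => RBC.rate_bound hL hsρ (Real.sqrt_le_sqrt hRa.2) ((div_le_iff₀ hsρ).1 hη1.le)
      (fun j k hj hk hne => Real.sqrt_le_sqrt (hgap j k hj hk hne)) hi) hψ hψs
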